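/- Let $\rho=1.75$, $\varrho_0=5.79833984375\times10^{-4}$, $\delta=0.00124359130859375$. Let $\mathcal A_s(\rho)$ be the complex Banach space of power series $s(x,y)=\sum_{i,j\ge0}c_{ij}x^iy^j$ with $\|s\|_\rho=\sum|c_{ij}|\rho^{i+j}<\infty$ and $\partial_1s(x,y)=\partial_1s(y,x)$, and write $\mathcal D_r=\{(x,y)\in\mathbb C^2:|x|,|y|<r\}$. Subscripts $1,2$ denote partial derivatives and $f_{(i,j)}$ denotes a Taylor coefficient at the origin. Let $s_0\in\mathcal A_s(\rho)$ be a polynomial, let $s^*\in\mathcal B_{\varrho_0}(s_0)\subset\mathcal A_s(\rho)$, and let $U\subset\mathcal A_s(\rho)$ be an open neighbourhood of $s^*$ on which the following operators are defined. (a) For some $0<r\le\rho$ there is a continuous function $(s,x,y)\mapsto Z[s](x,y)$ on $U\times\mathcal D_r$ with $|Z|<\rho$ such that $z=Z[s](x,y)$ is a simple root of $s(x,z)+s(y,z)=0$. Put $G[s](x,y)=(Z[s](x,y),y)$. (b) For a function $t:U\to\mathbb C$ put $\mathcal P_t[s](x,y)=(1+2t[s]y)\,(s\circ G[s])(x+t[s]x^2,\,y+t[s]y^2)$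 and $\mathcal R_t[s](x,y)=\mu[s]^{-1}\mathcal P_t[s](\lambda[s]x,\lambda[s]y)$, where $\lambda:U\to\mathbb C$ is continuous, $\mathcal P_t[s](\lambda[s],0)=0$, $\mu[s]=\lambda[s]\,\partial_1\mathcal P_t[s](\lambda[s],0)\neq0$, and $|\lambda[s]x+t[s](\lambda[s]x)^2|<r$ for $|x|\le\rho$. (c) $\mathcal R_{EKW}$ is the operator with $t\equiv0$. Suppose $\mathcal R_{EKW}[s^*]=s^*$, and let $\lambda_*=\lambda[s^*]$ be the corresponding scaling. Put $$\psi(x,y)=s^*_1x^2+s^*_2y^2+2s^*y-s^*-(s^*_1x+s^*_2y).$$ (d) $\mathcal R$ is the operator with $$t[s]=-\lambda_*^{-1}\,\ell\big(E(\lambda_*)(\mathcal R_{EKW}[s]-s^*)\big),\qquad E(\lambda_*)=\frac1{2\pi i}\oint_{|z-\lambda_*|=\varepsilon}(z-D\mathcal R_{EKW}[s^*])^{-1}dz,$$ where $\varepsilon>0$ is such that the closed disk $|z-\lambda_*|\le\varepsilon$ contains no point of ${\rm spec}(D\mathcal R_{EKW}[s^*])$ except possibly $\lambda_*$, and $\ell$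 is any bounded linear functional on $\mathcal A_s(\rho)$ with $\ell(\psi)=1$ (if $E(\lambda_*)$ has rank one, $\ell(E(\lambda_*)v)$ is the coefficient $a$ in $E(\lambda_*)v=a\psi$). (e) $\mathcal R_{c^*}$ is the operator with $$t[s]=\frac14\,\frac{c^*-(s\circ G[s])_{(0,3)}}{(s\circ G[s])_{(0,2)}},\qquad c^*=(s^*\circ G[s^*])_{(0,3)},$$ where $(s\circ G[s])_{(0,2)}\ne0$ on $U$. Suppose that $s^*$ is a fixed point of $\mathcal R$ and of $\mathcal R_{c^*}$, the scalings $\lambda[s^*]$ of these two operators being $\lambda_*$ as well. Then $\mathcal R_{EKW}$, $\mathcal R$ and $\mathcal R_{c^*}$ are (complex) differentiable at $s^*$, and $${\rm spec}\left(D\mathcal R[s^*]\right)\setminus\{z\in\mathbb C:|z|\le\delta\}\subset{\rm spec}\left(D\mathcal R_{c^*}[s^*]\right)\setminus\{z\in\mathbb C:|z|\le\delta\}.$$ -/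

import Mathlib

open scoped Nat

noncomputable section

/-- The radius `ρ = 1.75` of the bidisk. -/
def rho : ℝ := 7 / 4

/-- The radius `ϱ₀ = 5.79833984375 × 10⁻⁴` of the ball around `s₀`. -/
def varrho0 : ℝ := 5.79833984375e-4

/-- `δ = 0.00124359130859375`. -/
def deltaBound : ℝ := 0.00124359130859375

/-- The Banach space `𝒜(ρ)` of power series `s(x,y) = ∑ c i j x^i y^j` with
`‖s‖ = ∑ |c i j| ρ^(i+j) < ∞`.  An element is stored as the summable family of the weighted
coefficients `c i j * ρ^(i+j)`, so that the norm of `ℓ¹` is the norm of `𝒜(ρ)`. -/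
abbrev FunSpace : Type := lp (fun _ : ℕ × ℕ => ℂ) 1

/-- The Taylor coefficient `c i j` of `s` at the origin. -/
def FunSpace.coeff (s : FunSpace) (i j : ℕ) : ℂ := s (i, j) / (rho : ℂ) ^ (i + j)

/-- The value `s(x,y) = ∑ c i j x^i y^j`, meaningful for `|x|, |y| ≤ ρ`. -/
def FunSpace.eval (s : FunSpace) (x y : ℂ) : ℂ :=
  ∑' p : ℕ × ℕ, s.coeff p.1 p.2 * x ^ p.1 * y ^ p.2

/-- The symmetric subspace `𝒜_s(ρ) = {s : ∂₁s(x,y) = ∂₁s(y,x)}`.  The coefficient of `x^i y^j`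
in `∂₁s(x,y)` is `(i+1) c (i+1) j`, in `∂₁s(y,x)` it is `(j+1) c (j+1) i`. -/
def symSubmodule : Submodule ℂ FunSpace where
  carrier := {s | ∀ i j : ℕ, ((i : ℂ) + 1) * s.coeff (i + 1) j = ((j : ℂ) + 1) * s.coeff (j + 1) i}
  zero_mem' := by
    intro i j
    simp [FunSpace.coeff]
  add_mem' := by
    intro a b ha hb i j
    have h1 := ha i j
    have h2 := hb i j
    simp only [FunSpace.coeff, lp.coeFn_add, Pi.add_apply, add_div, mul_add] at h1 h2 ⊢
    rw [h1, h2]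
  smul_mem' := by
    intro k a ha i j
    have h1 := ha i j
    simp only [FunSpace.coeff, lp.coeFn_smul, Pi.smul_apply, smul_eq_mul, mul_div_assoc] at h1 ⊢
    rw [mul_left_comm, h1, mul_left_comm]

/-- The Banach space `𝒜_s(1.75)`. -/
abbrev SymSpace : Type := symSubmodule

theorem FunSpace.continuous_coeff (i j : ℕ) : Continuous fun s : FunSpace => s.coeff i j := by
  have h : LipschitzWith 1 fun s : FunSpace => s (i, j) := by
    refine LipschitzWith.of_dist_le_mul fun s t => ?_
    rw [dist_eq_norm, dist_eq_norm, NNReal.coe_one, one_mul]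
    have := lp.norm_apply_le_norm (p := 1) one_ne_zero (s - t) (i, j)
    simpa using this
  exact h.continuous.div_const _

instance : CompleteSpace SymSpace := by
  have h : IsClosed (symSubmodule : Set FunSpace) := by
    have : (symSubmodule : Set FunSpace) = ⋂ (i : ℕ) (j : ℕ),
        {s : FunSpace | ((i : ℂ) + 1) * s.coeff (i + 1) j = ((j : ℂ) + 1) * s.coeff (j + 1) i} := by
      ext s
      simp only [Set.mem_iInter]
      rfl
    rw [this]
    exact isClosed_iInter fun i => isClosed_iInter fun j =>
      isClosed_eq (continuous_const.mul (FunSpace.continuous_coeff _ _))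
        (continuous_const.mul (FunSpace.continuous_coeff _ _))
  exact h.completeSpace_coe

/-- The value `s(x,y)` for `s ∈ 𝒜_s(ρ)`. -/
def ev (s : SymSpace) (x y : ℂ) : ℂ := FunSpace.eval s.1 x y

/-- `s` is a polynomial. -/
def IsPolynomial (s : SymSpace) : Prop := {p : ℕ × ℕ | s.1 p ≠ 0}.Finite

/-- The open bidisk `𝒟_r = {(x,y) : |x| < r, |y| < r}`. -/
def bidisk (r : ℝ) : Set (ℂ × ℂ) := {p | ‖p.1‖ < r ∧ ‖p.2‖ < r}

open Classical in
/-- The element of `𝒜_s(ρ)` whose restriction to `𝒟_ρ` is `f` (it is unique);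
`0` if there is none. -/
def ofFun (f : ℂ → ℂ → ℂ) : SymSpace :=
  if h : ∃ g : SymSpace, ∀ x y : ℂ, (x, y) ∈ bidisk rho → ev g x y = f x y
  then Classical.choose h else 0

/-- `Z[s](x,y)`, for `s ∈ U` and `(x,y) ∈ 𝒟_r`, is a continuous branch of simple solutions `z`, in
the disk `|z| < ρ`, of the midpoint equation `s(x,z) + s(y,z) = 0`. -/
structure IsMidpointBranch (U : Set SymSpace) (r : ℝ) (Z : SymSpace → ℂ × ℂ → ℂ) : Prop where
  r_pos : 0 < r
  r_le : r ≤ rho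
  cont : ContinuousOn (fun q : SymSpace × (ℂ × ℂ) => Z q.1 q.2) (U ×ˢ bidisk r)
  norm_lt : ∀ s ∈ U, ∀ p ∈ bidisk r, ‖Z s p‖ < rho
  midpoint : ∀ s ∈ U, ∀ p ∈ bidisk r, ev s p.1 (Z s p) + ev s p.2 (Z s p) = 0
  simple : ∀ s ∈ U, ∀ p ∈ bidisk r, deriv (fun z => ev s p.1 z + ev s p.2 z) (Z s p) ≠ 0

/-- The prerenormalization `𝒫_EKW[s] = s ∘ G[s]`, `G[s](x,y) = (Z[s](x,y), y)`. -/
def preEKW (Z : SymSpace → ℂ × ℂ → ℂ) (s : SymSpace) (x y : ℂ) : ℂ := ev s (Z s (x, y)) y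

/-- The Taylor coefficient `(s ∘ G[s])_(0,j)` at the origin. -/
def preCoeff (Z : SymSpace → ℂ × ℂ → ℂ) (s : SymSpace) (j : ℕ) : ℂ :=
  iteratedDeriv j (fun y => preEKW Z s 0 y) 0 / (j ! : ℂ)

/-- The prerenormalization with the change of coordinates of parameter `t = t[s]`:
`(1 + 2 t y) s(G[s](ξ_t(x,y)))`, `ξ_t(x,y) = (x + t x², y + t y²)`. -/
def pre (Z : SymSpace → ℂ × ℂ → ℂ) (t : SymSpace → ℂ) (s : SymSpace) (x y : ℂ) : ℂ :=
  (1 + 2 * t s * y) * preEKW Z s (x + t s * x ^ 2) (y + t s * y ^ 2)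

/-- The scaling `μ[s] = λ[s] ∂₁𝒫[s](λ[s],0)`. -/
def mu (Z : SymSpace → ℂ × ℂ → ℂ) (t lam : SymSpace → ℂ) (s : SymSpace) : ℂ :=
  lam s * deriv (fun x => pre Z t s x 0) (lam s)

/-- `λ[s]`, for `s ∈ U`, is a continuous branch of solutions of `𝒫[s](λ[s],0) = 0`, such that
`μ[s] ≠ 0` and `𝒫[s](λ[s] x, λ[s] y)` only involves values of `Z[s]` on `𝒟_r`
for `|x|, |y| ≤ ρ`. -/
structure IsScaling (U : Set SymSpace) (r : ℝ) (Z : SymSpace → ℂ × ℂ → ℂ)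
    (t lam : SymSpace → ℂ) : Prop where
  cont : ContinuousOn lam U
  domain : ∀ s ∈ U, ∀ x : ℂ, ‖x‖ ≤ rho → ‖lam s * x + t s * (lam s * x) ^ 2‖ < r
  zero : ∀ s ∈ U, pre Z t s (lam s) 0 = 0
  mu_ne_zero : ∀ s ∈ U, mu Z t lam s ≠ 0

/-- The renormalization operator `s ↦ μ[s]⁻¹ 𝒫[s](λ[s] x, λ[s] y)` on `𝒜_s(ρ)`. -/
def renorm (Z : SymSpace → ℂ × ℂ → ℂ) (t lam : SymSpace → ℂ) (s : SymSpace) : SymSpace :=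
  ofFun fun x y => (mu Z t lam s)⁻¹ * pre Z t s (lam s * x) (lam s * y)

/-- The operator `ℛ_EKW`: no change of coordinates. -/
def renormEKW (Z : SymSpace → ℂ × ℂ → ℂ) (lam : SymSpace → ℂ) : SymSpace → SymSpace :=
  renorm Z (fun _ => 0) lam

/-- The function `ψ(x,y) = s₁ x² + s₂ y² + 2 s y - s - (s₁ x + s₂ y)`, an eigenvector of
`Dℛ_EKW[s]` for the eigenvalue `λ[s]` at a fixed point `s` of `ℛ_EKW`. -/
def psiEKW (s : SymSpace) : SymSpace :=
  ofFun fun x y =>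
    deriv (fun x' => ev s x' y) x * x ^ 2 + deriv (fun y' => ev s x y') y * y ^ 2
      + 2 * ev s x y * y - ev s x y
      - (deriv (fun x' => ev s x' y) x * x + deriv (fun y' => ev s x y') y * y)

/-- The circle of centre `κ` and radius `ε` encloses no point of the spectrum of `L`
other than `κ`, and meets no point of it. -/
def Isolates (L : SymSpace →L[ℂ] SymSpace) (κ : ℂ) (ε : ℝ) : Prop :=
  0 < ε ∧ ∀ z ∈ spectrum ℂ L, ‖z - κ‖ ≤ ε → z = κ

/-- The Riesz projection `E(κ) = (2πi)⁻¹ ∮_{|z-κ|=ε} (z - L)⁻¹ dz`. -/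
def rieszProj (L : SymSpace →L[ℂ] SymSpace) (κ : ℂ) (ε : ℝ) : SymSpace →L[ℂ] SymSpace :=
  (2 * (Real.pi : ℂ) * Complex.I)⁻¹ • ∮ z in C(κ, ε), resolvent L z

/-- The parameter `t[s] = - λ_*⁻¹ ℓ(E(λ_*)(ℛ_EKW[s] - s^*))` of the operator `ℛ`, where
`λ_* = λ[s^*]` and `E(λ_*)` is the Riesz projection of `Dℛ_EKW[s^*]`.  Here `ℓ` is a
functional with `ℓ(ψ) = 1`: when `E(λ_*)` has rank one, `ℓ(E(λ_*) v)` is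
the coefficient `a` in `E(λ_*) v = a ψ`, of modulus `‖E(λ_*) v‖ / ‖ψ‖`. -/
def tRiesz (Z : SymSpace → ℂ × ℂ → ℂ) (lamE : SymSpace → ℂ) (sStar : SymSpace) (ε : ℝ)
    (l : SymSpace →L[ℂ] ℂ) (s : SymSpace) : ℂ :=
  -(lamE sStar)⁻¹ *
    l (rieszProj (fderiv ℂ (renormEKW Z lamE) sStar) (lamE sStar) ε (renormEKW Z lamE s - sStar))

/-- The parameter `t_c[s] = (c - (s ∘ G[s])_(0,3)) / (4 (s ∘ G[s])_(0,2))` of `ℛ_c`. -/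
def tCoeff (Z : SymSpace → ℂ × ℂ → ℂ) (c : ℂ) (s : SymSpace) : ℂ :=
  1 / 4 * ((c - preCoeff Z s 3) / preCoeff Z s 2)

end

open scoped ContDiff

open Filter Topology Metric

/-! ### Uniqueness of power series in one and two variables -/

/-! Both parameters `t` vanish at `s^*`, so to first order a coordinate change adds only its
generator, multiplied by `λ_* Dt[s^*] v`. Variations of `λ` and `μ` add multiples of the scaling and
multiplication generators. The normalization `s(1,0) = 0`, `∂₁s(1,0) = 1`, shared by all
renormalized functions, forces the total correction to be a multiple of `ψ`: `Dℛ_t v = Dℛ_EKW v +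
λ_* (Dt v) ψ` (`IsScaling.fderiv_renorm_eq`).

The function `ψ` is the derivative at `ε = 0` of `(1 + ε(2y - 1)) s(x + ε(x² - x), y + ε(y² - y))`.
Such a change of coordinates carries midpoints to midpoints, so it passes through `s ↦ s ∘ G[s]`.
Rescaling by `λ_*` multiplies its quadratic part by `λ_*`, and the normalization fixes the rest, so
`Dℛ_EKW ψ = λ_* ψ` (`IsScaling.fderiv_renormEKW_psi`). The Riesz projection fixes `ψ`, hence `Dt ψ =
-1` for the operator `ℛ` and `Dℛ ψ = 0`. For `ℛ_{c^*}`, `ψ` is an eigenvector with some other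
eigenvalue.

Thus the two derivatives agree modulo the invariant line spanned by `ψ`, and the first vanishes on
it. Every nonzero spectral point of `Dℛ` is then one of `Dℛ_{c^*}`
(`mem_spectrum_of_eq_mod_eigenvector`), and `0` lies in the excised disk.

The analytic part is differentiability into the weighted `ℓ¹` space. Evaluation is jointly analytic
in `s` and the point. The implicit function theorem transfers smoothness to `Z` and
differentiability to `λ`. A Cauchy integral over a torus of radius larger than `ρ` turns a scalar
`C¹` family into a differentiable `ℓ¹`-valued one (`exists_differentiableAt_funSpace`). -/

theorem powerSeries_coeff_eq_zero {a : ℕ → ℂ} {q : ℝ} (hq : 0 < q)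
    (h : ∀ x : ℂ, ‖x‖ < q → HasSum (fun n => a n * x ^ n) 0) (n : ℕ) : a n = 0 := by
  let P : FormalMultilinearSeries ℂ ℂ ℂ :=
    fun n => ContinuousMultilinearMap.mkPiRing ℂ (Fin n) (a n)
  have h1 : HasFPowerSeriesAt (0 : ℂ → ℂ) P 0 := by
    refine hasFPowerSeriesAt_iff.2 ?_
    filter_upwards [ball_mem_nhds (0 : ℂ) hq] with z hz
    simpa [FormalMultilinearSeries.coeff, mul_comm, P] using h z (by simpa using hz)
  have h2 := congrArg (fun p => FormalMultilinearSeries.coeff p n) h1.eq_zero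
  simpa [FormalMultilinearSeries.coeff, P] using h2

theorem summable_powerSeries₂ {c : ℕ × ℕ → ℂ} {q : ℝ}
    (hc : Summable fun p : ℕ × ℕ => ‖c p‖ * q ^ (p.1 + p.2)) {x y : ℂ} (hx : ‖x‖ ≤ q)
    (hy : ‖y‖ ≤ q) : Summable fun p : ℕ × ℕ => c p * x ^ p.1 * y ^ p.2 := by
  refine Summable.of_norm_bounded hc fun p => ?_
  have hq : 0 ≤ q := (norm_nonneg x).trans hx
  rw [norm_mul, norm_mul, norm_pow, norm_pow, mul_assoc, pow_add]
  gcongr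

/-- Grouping the double series by powers of `x`, one-variable uniqueness kills the sum of each row,
then each entry of the row. -/
theorem powerSeries₂_coeff_eq_zero {c : ℕ × ℕ → ℂ} {q : ℝ} (hq : 0 < q)
    (hc : Summable fun p : ℕ × ℕ => ‖c p‖ * q ^ (p.1 + p.2))
    (h : ∀ x y : ℂ, ‖x‖ < q → ‖y‖ < q → ∑' p : ℕ × ℕ, c p * x ^ p.1 * y ^ p.2 = 0)
    (p : ℕ × ℕ) : c p = 0 := by
  have hrow (i : ℕ) {y : ℂ} (hy : ‖y‖ < q) : Summable fun j => c (i, j) * y ^ j := by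
    have h1 := (summable_powerSeries₂ hc (x := (q : ℂ)) (by simp [abs_of_pos hq]) hy.le).comp_injective
      (Prod.mk_right_injective i)
    have hq' : (q : ℂ) ^ i ≠ 0 := pow_ne_zero _ (by exact_mod_cast hq.ne')
    refine (h1.mul_left ((q : ℂ) ^ i)⁻¹).congr fun j => ?_
    simp only [Function.comp]
    field_simp
  have hzero (i : ℕ) {y : ℂ} (hy : ‖y‖ < q) : ∑' j, c (i, j) * y ^ j = 0 := by
    refine powerSeries_coeff_eq_zero (a := fun i => ∑' j, c (i, j) * y ^ j) hq (fun x hx => ?_) i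
    have h1 := (summable_powerSeries₂ hc hx.le hy.le).hasSum
    rw [h x y hx hy] at h1
    refine h1.prod_fiberwise fun i => ?_
    exact ((hrow i hy).hasSum.mul_right (x ^ i)).congr_fun fun j => by ring
  obtain ⟨i, j⟩ := p
  refine powerSeries_coeff_eq_zero (a := fun j => c (i, j)) hq (fun y hy => ?_) j
  rw [← hzero i hy]
  exact (hrow i hy).hasSum

/-! ### Evaluation on the space of power series -/

theorem rho_pos : 0 < rho := by norm_num [rho]

theorem rho_ne_zero : (rho : ℂ) ≠ 0 := by exact_mod_cast rho_pos.ne'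

theorem mem_bidisk_iff {r : ℝ} {p : ℂ × ℂ} : p ∈ bidisk r ↔ ‖p‖ < r := by
  simp [bidisk, Prod.norm_def]

theorem bidisk_eq_ball (r : ℝ) : bidisk r = ball 0 r := by
  ext p; simp [mem_bidisk_iff]

theorem isOpen_bidisk (r : ℝ) : IsOpen (bidisk r) := by
  rw [bidisk_eq_ball]; exact isOpen_ball

namespace FunSpace

theorem summable_norm (s : FunSpace) : Summable fun p => ‖s p‖ := by
  simpa using s.2.summable

theorem norm_eq_tsum (s : FunSpace) : ‖s‖ = ∑' p, ‖s p‖ := by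
  simp [lp.norm_eq_tsum_rpow (p := 1) (by simp) s]

theorem norm_coeff_mul (s : FunSpace) (p : ℕ × ℕ) :
    ‖s.coeff p.1 p.2‖ * rho ^ (p.1 + p.2) = ‖s p‖ := by
  have : rho ^ (p.1 + p.2) ≠ 0 := pow_ne_zero _ rho_pos.ne'
  simp only [coeff, Prod.mk.eta, norm_div, norm_pow, Complex.norm_real, Real.norm_eq_abs,
    abs_of_pos rho_pos]
  field_simp

theorem summable_coeff (s : FunSpace) :
    Summable fun p : ℕ × ℕ => ‖s.coeff p.1 p.2‖ * rho ^ (p.1 + p.2) := by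
  simpa only [norm_coeff_mul] using s.summable_norm

theorem coeff_injective {s t : FunSpace} (h : ∀ i j, s.coeff i j = t.coeff i j) : s = t := by
  refine lp.ext (funext fun p => ?_)
  have h1 := h p.1 p.2
  have h2 : (rho : ℂ) ^ (p.1 + p.2) ≠ 0 := pow_ne_zero _ rho_ne_zero
  simpa [coeff, div_left_inj' h2] using h1

/-- Reindexing of the coefficients along an injective map. -/
noncomputable def compInj (f : ℕ × ℕ → ℕ × ℕ) (hf : f.Injective) : FunSpace →L[ℂ] FunSpace :=
  LinearMap.mkContinuous
    { toFun := fun s => ⟨fun p => s (f p), memℓp_gen (by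
        simpa [Function.comp_def] using s.summable_norm.comp_injective hf)⟩
      map_add' := fun _ _ => rfl
      map_smul' := fun _ _ => rfl } 1 (fun s => by
        rw [one_mul, norm_eq_tsum, norm_eq_tsum]
        exact (s.summable_norm.comp_injective hf).tsum_le_tsum_of_inj f hf
          (fun _ _ => norm_nonneg _) (fun _ => le_rfl) s.summable_norm)

theorem norm_compInj_le (f : ℕ × ℕ → ℕ × ℕ) (hf : f.Injective) : ‖compInj f hf‖ ≤ 1 :=
  LinearMap.mkContinuous_norm_le _ zero_le_one _

/-- Division by `x`, up to the constant term, in weighted coefficients. -/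
noncomputable def shiftFst : FunSpace →L[ℂ] FunSpace :=
  compInj (fun p => (p.1 + 1, p.2)) fun p q h => by simpa [Prod.ext_iff] using h

/-- Division by `y`, up to the constant term, in weighted coefficients. -/
noncomputable def shiftSnd : FunSpace →L[ℂ] FunSpace :=
  compInj (fun p => (p.1, p.2 + 1)) fun p q h => by simpa [Prod.ext_iff] using h

theorem shiftFst_pow_apply (n : ℕ) (s : FunSpace) (p : ℕ × ℕ) :
    (shiftFst ^ n) s p = s (p.1 + n, p.2) := by
  induction n generalizing p with
  | zero => rfl
  | succ n ih =>
    have h1 := ih (p.1 + 1, p.2)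
    rw [pow_succ']
    refine h1.trans ?_
    rw [Nat.add_assoc, Nat.add_comm 1 n]

theorem shiftSnd_pow_apply (n : ℕ) (s : FunSpace) (p : ℕ × ℕ) :
    (shiftSnd ^ n) s p = s (p.1, p.2 + n) := by
  induction n generalizing p with
  | zero => rfl
  | succ n ih =>
    have h1 := ih (p.1, p.2 + 1)
    rw [pow_succ']
    refine h1.trans ?_
    rw [Nat.add_assoc, Nat.add_comm 1 n]

theorem norm_smul_lt_one {S : FunSpace →L[ℂ] FunSpace} (hS : ‖S‖ ≤ 1) {x : ℂ} (hx : ‖x‖ < rho) :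
    ‖(x / rho) • S‖ < 1 := by
  have h1 : ‖x / rho‖ < 1 := by
    rw [norm_div, Complex.norm_real, Real.norm_eq_abs, abs_of_pos rho_pos, div_lt_one rho_pos]
    exact hx
  calc ‖(x / rho) • S‖ ≤ ‖x / rho‖ * 1 := by
        rw [norm_smul]; gcongr
    _ < 1 := by simpa using h1

/-- This is the Neumann series of `(1 - (x/ρ) S)⁻¹`, read at one entry. -/
theorem inverse_apply {S : FunSpace →L[ℂ] FunSpace} (hS : ‖S‖ ≤ 1) {x : ℂ} (hx : ‖x‖ < rho)
    (s : FunSpace) (p : ℕ × ℕ) :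
    HasSum (fun n => (x / rho) ^ n * (S ^ n) s p) (Ring.inverse (1 - (x / rho : ℂ) • S) s p) := by
  have h1 := norm_smul_lt_one hS hx
  have h2 := (summable_geometric_of_norm_lt_one h1).hasSum
  rw [geom_series_eq_inverse _ h1] at h2
  have h3 := h2.mapL (((lp.evalCLM ℂ (fun _ : ℕ × ℕ => ℂ) 1 p)).comp
    (ContinuousLinearMap.apply ℂ FunSpace s))
  refine h3.congr_fun fun n => ?_
  rw [smul_pow]
  rfl

/-- Evaluation at `p` as a continuous linear functional, for `‖p‖ < ρ`. -/
noncomputable def evalL (p : ℂ × ℂ) : FunSpace →L[ℂ] ℂ :=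
  (lp.evalCLM ℂ (fun _ : ℕ × ℕ => ℂ) 1 (0, 0)).comp
    ((Ring.inverse (1 - (p.1 / rho : ℂ) • shiftFst)).comp
      (Ring.inverse (1 - (p.2 / rho : ℂ) • shiftSnd)))

theorem norm_shiftFst_le : ‖shiftFst‖ ≤ 1 := norm_compInj_le _ _

theorem norm_shiftSnd_le : ‖shiftSnd‖ ≤ 1 := norm_compInj_le _ _

theorem coeff_mul_eq (s : FunSpace) (x y : ℂ) (p : ℕ × ℕ) :
    s.coeff p.1 p.2 * x ^ p.1 * y ^ p.2 = (x / rho) ^ p.1 * ((y / rho) ^ p.2 * s p) := by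
  have : (rho : ℂ) ≠ 0 := rho_ne_zero
  simp only [coeff, Prod.mk.eta, pow_add, div_pow]
  field_simp

/-- The shift powers bring the weighted coefficient `(i, j)` to the entry `(0, 0)`, with factor
`(x/ρ)^i (y/ρ)^j` from the two Neumann series. -/
theorem evalL_apply {p : ℂ × ℂ} (hp : ‖p‖ < rho) (s : FunSpace) :
    evalL p s = s.eval p.1 p.2 := by
  have hp1 : ‖p.1‖ < rho := (norm_fst_le p).trans_lt hp
  have hp2 : ‖p.2‖ < rho := (norm_snd_le p).trans_lt hp
  have h1 := inverse_apply norm_shiftFst_le hp1 (Ring.inverse (1 - (p.2 / rho : ℂ) • shiftSnd) s)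
    (0, 0)
  have h2 := (summable_powerSeries₂ s.summable_coeff hp1.le hp2.le).hasSum
  have h3 := h2.prod_fiberwise (g := fun i => (p.1 / rho) ^ i *
    (shiftFst ^ i) (Ring.inverse (1 - (p.2 / rho : ℂ) • shiftSnd) s) (0, 0)) fun i => by
      have h4 := (inverse_apply norm_shiftSnd_le hp2 s (i, 0)).mul_left ((p.1 / rho) ^ i)
      rw [shiftFst_pow_apply]
      simp only [zero_add]
      refine h4.congr_fun fun j => ?_
      rw [coeff_mul_eq s p.1 p.2 (i, j), shiftSnd_pow_apply, zero_add]
  exact h1.unique h3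

theorem contDiffAt_inverse {n : WithTop ℕ∞} {S : FunSpace →L[ℂ] FunSpace} (hS : ‖S‖ ≤ 1) {x : ℂ}
    (hx : ‖x‖ < rho) :
    ContDiffAt ℂ n (fun x : ℂ => Ring.inverse (1 - (x / rho : ℂ) • S)) x := by
  have h1 := contDiffAt_ringInverse ℂ (n := n) (Units.oneSub _ (norm_smul_lt_one hS hx))
  refine ContDiffAt.comp x (f := fun x : ℂ => 1 - (x / rho : ℂ) • S) h1 ?_
  fun_prop

/-- Inversion is analytic on units, so the functional depends smoothly on the point in operator
norm. This is the purpose of defining `evalL` by inverses of operators. -/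
theorem contDiffAt_evalL {n : WithTop ℕ∞} {p : ℂ × ℂ} (hp : ‖p‖ < rho) :
    ContDiffAt ℂ n evalL p := by
  have hp1 : ‖p.1‖ < rho := (norm_fst_le p).trans_lt hp
  have hp2 : ‖p.2‖ < rho := (norm_snd_le p).trans_lt hp
  have h1 := ContDiffAt.comp p (contDiffAt_inverse (n := n) norm_shiftFst_le hp1) contDiffAt_fst
  have h2 := ContDiffAt.comp p (contDiffAt_inverse (n := n) norm_shiftSnd_le hp2) contDiffAt_snd
  exact contDiffAt_const.clm_comp (h1.clm_comp h2)

theorem eq_of_eval_eq {s t : FunSpace}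
    (h : ∀ p ∈ bidisk rho, s.eval p.1 p.2 = t.eval p.1 p.2) : s = t := by
  rw [← sub_eq_zero]
  refine coeff_injective fun i j => ?_
  have h0 : (0 : FunSpace).coeff i j = 0 := by simp [coeff]
  rw [h0]
  refine powerSeries₂_coeff_eq_zero (c := fun p => (s - t).coeff p.1 p.2) rho_pos
    (s - t).summable_coeff (fun x y hx hy => ?_) (i, j)
  have hp : ‖((x, y) : ℂ × ℂ)‖ < rho := by simp [Prod.norm_def, hx, hy]
  have h1 := evalL_apply hp (s - t)
  rw [map_sub, evalL_apply hp, evalL_apply hp, h _ (mem_bidisk_iff.2 hp), sub_self] at h1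
  exact h1.symm

end FunSpace

/-! ### Holomorphic families of functions on a polydisk, as families in `FunSpace` -/

namespace FunSpace

/-- The element of `FunSpace` with weighted coefficients `a ^ i * b ^ j`, that is, the function
`(1 - a x / ρ)⁻¹ (1 - b y / ρ)⁻¹`. -/
noncomputable def cauchyKernel (q : ℂ × ℂ) : FunSpace :=
  ∑' p : ℕ × ℕ, (q.1 ^ p.1 * q.2 ^ p.2) • (lp.single 1 p (1 : ℂ) : FunSpace)

theorem norm_cauchyKernel_term_le {c : ℝ} {q : ℂ × ℂ} (hq : ‖q‖ ≤ c) (p : ℕ × ℕ) :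
    ‖(q.1 ^ p.1 * q.2 ^ p.2) • (lp.single 1 p (1 : ℂ) : FunSpace)‖ ≤ c ^ p.1 * c ^ p.2 := by
  have h1 : ‖q.1‖ ≤ c := (norm_fst_le q).trans hq
  have h2 : ‖q.2‖ ≤ c := (norm_snd_le q).trans hq
  have hc : 0 ≤ c := (norm_nonneg q).trans hq
  rw [norm_smul, lp.norm_single (by norm_num), norm_one, mul_one, norm_mul, norm_pow, norm_pow]
  gcongr

theorem summable_geometric_prod {c : ℝ} (h0 : 0 ≤ c) (h1 : c < 1) :
    Summable fun p : ℕ × ℕ => c ^ p.1 * c ^ p.2 :=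
  (summable_geometric_of_lt_one h0 h1).mul_of_nonneg (summable_geometric_of_lt_one h0 h1)
    (fun _ => pow_nonneg h0 _) (fun _ => pow_nonneg h0 _)

theorem hasSum_cauchyKernel {q : ℂ × ℂ} (hq : ‖q‖ < 1) :
    HasSum (fun p : ℕ × ℕ => (q.1 ^ p.1 * q.2 ^ p.2) • (lp.single 1 p (1 : ℂ) : FunSpace))
      (cauchyKernel q) :=
  (Summable.of_norm_bounded (summable_geometric_prod (norm_nonneg q) hq)
    fun p => norm_cauchyKernel_term_le le_rfl p).hasSum

theorem continuousOn_cauchyKernel {c : ℝ} (h0 : 0 ≤ c) (h1 : c < 1) :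
    ContinuousOn cauchyKernel {q | ‖q‖ ≤ c} := by
  refine continuousOn_tsum (fun p => ?_) (summable_geometric_prod h0 h1)
    fun p q hq => norm_cauchyKernel_term_le hq p
  fun_prop

theorem eval_single (p : ℕ × ℕ) (x y : ℂ) :
    eval (lp.single 1 p (1 : ℂ)) x y = (x / rho) ^ p.1 * (y / rho) ^ p.2 := by
  rw [eval, tsum_eq_single p]
  · rw [coeff_mul_eq]
    simp
  · intro p' hp'
    rw [coeff_mul_eq]
    simp [hp']

/-- A product of two geometric series. At `q = (ρ/z, ρ/w)` it becomes the Cauchy kernel `(1 - x/z)⁻¹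
(1 - y/w)⁻¹`. -/
theorem evalL_cauchyKernel {p q : ℂ × ℂ} (hp : ‖p‖ < rho) (hq : ‖q‖ < 1) :
    evalL p (cauchyKernel q) = (1 - q.1 * p.1 / rho)⁻¹ * (1 - q.2 * p.2 / rho)⁻¹ := by
  have h1 : ‖q.1 * p.1 / rho‖ < 1 := by
    rw [norm_div, norm_mul, Complex.norm_real, Real.norm_eq_abs, abs_of_pos rho_pos,
      div_lt_one rho_pos]
    have := norm_fst_le p
    have := norm_fst_le q
    nlinarith [norm_nonneg q.1, norm_nonneg p.1]
  have h2 : ‖q.2 * p.2 / rho‖ < 1 := by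
    rw [norm_div, norm_mul, Complex.norm_real, Real.norm_eq_abs, abs_of_pos rho_pos,
      div_lt_one rho_pos]
    have := norm_snd_le p
    have := norm_snd_le q
    nlinarith [norm_nonneg q.2, norm_nonneg p.2]
  have h3 := (hasSum_cauchyKernel hq).mapL (evalL p)
  have h4 := (summable_mul_of_summable_norm (summable_norm_geometric_of_norm_lt_one h1)
    (summable_norm_geometric_of_norm_lt_one h2)).hasSum
  rw [← tsum_mul_tsum_of_summable_norm (summable_norm_geometric_of_norm_lt_one h1)
    (summable_norm_geometric_of_norm_lt_one h2), tsum_geometric_of_norm_lt_one h1,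
    tsum_geometric_of_norm_lt_one h2] at h4
  refine h3.unique (h4.congr_fun fun i => ?_)
  rw [map_smul, evalL_apply hp, eval_single, smul_eq_mul]
  simp only [div_pow, mul_pow]
  ring

end FunSpace

open MeasureTheory in
/-- The Cauchy formula on a polydisk, with both circles parametrized by angles. -/
theorem cauchy_formula_polydisk {f : ℂ × ℂ → ℂ} {R : ℝ} (hR : 0 < R) {O : Set (ℂ × ℂ)}
    (hO : IsOpen O) (hRO : closedBall 0 R ⊆ O) (hf : DifferentiableOn ℂ f O) {p : ℂ × ℂ}
    (hp : ‖p‖ < R) :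
    ∫ q in Set.Icc (0 : ℝ) (2 * Real.pi) ×ˢ Set.Icc (0 : ℝ) (2 * Real.pi),
      f (circleMap 0 R q.1, circleMap 0 R q.2) * ((1 - p.1 / circleMap 0 R q.1)⁻¹ *
        (1 - p.2 / circleMap 0 R q.2)⁻¹) = (2 * Real.pi) ^ 2 * f p := by
  have hp1 : ‖p.1‖ < R := (norm_fst_le p).trans_lt hp
  have hp2 : ‖p.2‖ < R := (norm_snd_le p).trans_lt hp
  have hcm (θ : ℝ) : ‖circleMap 0 R θ‖ = R := by simp [abs_of_pos hR]
  have hcm0 (θ : ℝ) : circleMap 0 R θ ≠ 0 := by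
    rw [← norm_ne_zero_iff, hcm]; exact hR.ne'
  have hne {w : ℂ} (hw : ‖w‖ < R) (θ : ℝ) : 1 - w / circleMap 0 R θ ≠ 0 := by
    intro h
    rw [sub_eq_zero, eq_div_iff (hcm0 θ), one_mul] at h
    rw [← h, hcm] at hw
    exact lt_irrefl _ hw
  have hmem {z w : ℂ} (hz : ‖z‖ ≤ R) (hw : ‖w‖ ≤ R) : (z, w) ∈ O :=
    hRO (by simp [Prod.norm_def, hz, hw])
  -- On `z = R e^{iθ}` one has `dz/(z - w) = i (1 - w/z)⁻¹ dθ`, so the factor `i` cancels from the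
  -- Cauchy formula.
  have honed {g : ℂ → ℂ} (hg : DifferentiableOn ℂ g (closedBall 0 R)) {w : ℂ} (hw : ‖w‖ < R) :
      ∫ θ in Set.Icc (0 : ℝ) (2 * Real.pi), g (circleMap 0 R θ) * (1 - w / circleMap 0 R θ)⁻¹
        = 2 * Real.pi * g w := by
    have h1 := hg.circleIntegral_sub_inv_smul (w := w) (by simpa using hw)
    rw [circleIntegral_def_Icc] at h1
    have h2 : ∀ θ : ℝ, deriv (circleMap 0 R) θ • (circleMap 0 R θ - w)⁻¹ • g (circleMap 0 R θ) =
        Complex.I * (g (circleMap 0 R θ) * (1 - w / circleMap 0 R θ)⁻¹) := by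
      intro θ
      have h3 : circleMap 0 R θ - w = circleMap 0 R θ * (1 - w / circleMap 0 R θ) := by
        rw [mul_sub, mul_one, mul_div_cancel₀ _ (hcm0 θ)]
      rw [deriv_circleMap, h3, mul_inv, smul_eq_mul, smul_eq_mul]
      field_simp [hcm0 θ]
    simp only [h2] at h1
    rw [integral_const_mul] at h1
    have h4 : Complex.I ≠ 0 := Complex.I_ne_zero
    apply mul_left_cancel₀ h4
    rw [h1, smul_eq_mul]
    ring
  have hcont : Continuous fun q : ℝ × ℝ => f (circleMap 0 R q.1, circleMap 0 R q.2) *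
      ((1 - p.1 / circleMap 0 R q.1)⁻¹ * (1 - p.2 / circleMap 0 R q.2)⁻¹) := by
    have hc1 : Continuous fun q : ℝ × ℝ => circleMap 0 R q.1 :=
      (continuous_circleMap 0 R).comp continuous_fst
    have hc2 : Continuous fun q : ℝ × ℝ => circleMap 0 R q.2 :=
      (continuous_circleMap 0 R).comp continuous_snd
    have hf' : Continuous fun q : ℝ × ℝ => f (circleMap 0 R q.1, circleMap 0 R q.2) :=
      hf.continuousOn.comp_continuous (hc1.prodMk hc2)
        fun q => hmem (hcm _).le (hcm _).le
    refine hf'.mul (Continuous.mul ?_ ?_)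
    · exact (continuous_const.sub (continuous_const.div hc1 fun q => hcm0 _)).inv₀
        fun q => hne hp1 _
    · exact (continuous_const.sub (continuous_const.div hc2 fun q => hcm0 _)).inv₀
        fun q => hne hp2 _
  have hintg := hcont.continuousOn.integrableOn_compact (μ := volume)
    ((isCompact_Icc (a := (0 : ℝ)) (b := 2 * Real.pi)).prod
      (isCompact_Icc (a := (0 : ℝ)) (b := 2 * Real.pi)))
  rw [Measure.volume_eq_prod] at hintg ⊢
  rw [setIntegral_prod _ hintg]
  have hinner (θ : ℝ) : ∫ η in Set.Icc (0 : ℝ) (2 * Real.pi),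
      f (circleMap 0 R θ, circleMap 0 R η) * ((1 - p.1 / circleMap 0 R θ)⁻¹ *
        (1 - p.2 / circleMap 0 R η)⁻¹)
      = 2 * Real.pi * (f (circleMap 0 R θ, p.2) * (1 - p.1 / circleMap 0 R θ)⁻¹) := by
    have hd : DifferentiableOn ℂ (fun w => f (circleMap 0 R θ, w)) (closedBall 0 R) := by
      intro w hw
      have hw' : (circleMap 0 R θ, w) ∈ O := hmem (hcm θ).le (by simpa using hw)
      have h1 := (hf _ hw').differentiableAt (hO.mem_nhds hw')
      exact (h1.comp w (by fun_prop : DifferentiableAt ℂ (fun w => (circleMap 0 R θ, w)) w)).differentiableWithinAt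
    have h1 := honed hd hp2
    have h2 : ∀ η : ℝ, f (circleMap 0 R θ, circleMap 0 R η) * ((1 - p.1 / circleMap 0 R θ)⁻¹ *
        (1 - p.2 / circleMap 0 R η)⁻¹) = (1 - p.1 / circleMap 0 R θ)⁻¹ *
        (f (circleMap 0 R θ, circleMap 0 R η) * (1 - p.2 / circleMap 0 R η)⁻¹) := fun η => by
      ring
    simp only [h2]
    rw [integral_const_mul, h1]
    ring
  simp only [hinner]
  have hd : DifferentiableOn ℂ (fun w => f (w, p.2)) (closedBall 0 R) := by
    intro w hw
    have hw' : (w, p.2) ∈ O := hmem (by simpa using hw) hp2.le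
    have h1 := (hf _ hw').differentiableAt (hO.mem_nhds hw')
    exact (h1.comp w (by fun_prop : DifferentiableAt ℂ (fun w => (w, p.2)) w)).differentiableWithinAt
  rw [integral_const_mul, honed hd hp1]
  ring

open MeasureTheory in
/-- A `C¹` function on a neighbourhood of `{e₀}` times the closed polydisk of radius `ρ` gives
a family of elements of `FunSpace` that is differentiable at `e₀`. -/
theorem exists_differentiableAt_funSpace {E : Type*} [NormedAddCommGroup E] [NormedSpace ℂ E]
    {F : E × (ℂ × ℂ) → ℂ} {e₀ : E} {O : Set (E × (ℂ × ℂ))} (hO : IsOpen O)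
    (hmem : ∀ p : ℂ × ℂ, ‖p‖ ≤ rho → (e₀, p) ∈ O) (hF : ContDiffOn ℂ 1 F O) :
    ∃ Φ : E → FunSpace, DifferentiableAt ℂ Φ e₀ ∧
      ∀ᶠ e in 𝓝 e₀, ∀ p : ℂ × ℂ, ‖p‖ < rho → (Φ e).eval p.1 p.2 = F (e, p) := by
  -- The room beyond `ρ` makes `ρ/R < 1`, so that the kernel converges in `ℓ¹` on the torus of
  -- radius `R`.
  obtain ⟨R, hR, hRO⟩ : ∃ R, rho < R ∧ ∀ p : ℂ × ℂ, ‖p‖ ≤ R → (e₀, p) ∈ O := by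
    obtain ⟨δ, hδ, h⟩ := (isCompact_closedBall (0 : ℂ × ℂ) rho).exists_cthickening_subset_open
      (hO.preimage (by fun_prop : Continuous fun p : ℂ × ℂ => (e₀, p)))
      (fun p hp => hmem p (by simpa using hp))
    rw [cthickening_closedBall hδ.le rho_pos.le] at h
    exact ⟨δ + rho, by linarith, fun p hp => h (by simpa using hp)⟩
  have hR0 : 0 < R := rho_pos.trans hR
  let K : Set (ℂ × ℂ) := closedBall 0 R
  have hK : IsCompact K := isCompact_closedBall 0 R
  have hdiff {z : E × (ℂ × ℂ)} (hz : z ∈ O) : DifferentiableAt ℂ F z :=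
    (hF.contDiffAt (hO.mem_nhds hz)).differentiableAt one_ne_zero
  have hfd : ContinuousOn (fun z => fderiv ℂ F z) O := hF.continuousOn_fderiv_of_isOpen hO le_rfl
  have hV : ∀ᶠ e in 𝓝 e₀, ∀ p ∈ K, (e, p) ∈ O :=
    hK.eventually_forall_of_forall_eventually fun p hp =>
      hO.mem_nhds (hRO p (by simpa [K] using hp))
  -- Compactness of the polydisk gives a bound uniform in `e` near `e₀`, the domination needed to
  -- differentiate under the integral.
  obtain ⟨C, hC⟩ : ∃ C : ℝ, ∀ᶠ e in 𝓝 e₀, ∀ p ∈ K, ‖fderiv ℂ F (e, p)‖ ≤ C := by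
    obtain ⟨C, hC⟩ := hK.exists_bound_of_continuousOn (f := fun p => fderiv ℂ F (e₀, p))
      (hfd.comp (by fun_prop) fun p hp => hRO p (by simpa [K] using hp))
    refine ⟨C + 1, hK.eventually_forall_of_forall_eventually fun p hp => ?_⟩
    have h1 : ContinuousAt (fun z => ‖fderiv ℂ F z‖) (e₀, p) :=
      (hfd.continuousAt (hO.mem_nhds (hRO p (by simpa [K] using hp)))).norm
    filter_upwards [h1.eventually_lt continuousAt_const
      (show ‖fderiv ℂ F (e₀, p)‖ < C + 1 by linarith [hC p hp])] with z hz using hz.le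
  let cm : ℝ × ℝ → ℂ × ℂ := fun q => (circleMap 0 R q.1, circleMap 0 R q.2)
  have hcm : Continuous cm := by
    exact ((continuous_circleMap 0 R).comp continuous_fst).prodMk
      ((continuous_circleMap 0 R).comp continuous_snd)
  have hnorm (θ : ℝ) : ‖circleMap 0 R θ‖ = R := by simp [abs_of_pos hR0]
  have hcm0 (θ : ℝ) : circleMap 0 R θ ≠ 0 := by
    rw [← norm_ne_zero_iff, hnorm]; exact hR0.ne'
  have hcmK (q : ℝ × ℝ) : cm q ∈ K := by simp [K, cm, Prod.norm_def, hnorm]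
  let kq : ℝ × ℝ → ℂ × ℂ := fun q => (rho / circleMap 0 R q.1, rho / circleMap 0 R q.2)
  have hkq (q : ℝ × ℝ) : ‖kq q‖ ≤ rho / R := by
    simp [kq, Prod.norm_def, hnorm, abs_of_pos rho_pos]
  have hlt : rho / R < 1 := (div_lt_one hR0).2 hR
  have hker : Continuous fun q => FunSpace.cauchyKernel (kq q) := by
    refine (FunSpace.continuousOn_cauchyKernel (by have := rho_pos; positivity) hlt).comp_continuous
      ?_ hkq
    exact (continuous_const.div ((continuous_circleMap 0 R).comp continuous_fst)
      fun q => hcm0 _).prodMk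
      (continuous_const.div ((continuous_circleMap 0 R).comp continuous_snd) fun q => hcm0 _)
  let T : Set (ℝ × ℝ) := Set.Icc (0 : ℝ) (2 * Real.pi) ×ˢ Set.Icc (0 : ℝ) (2 * Real.pi)
  have hT : IsCompact T := isCompact_Icc.prod isCompact_Icc
  let G : E → ℝ × ℝ → FunSpace := fun e q => F (e, cm q) • FunSpace.cauchyKernel (kq q)
  let G' : E → ℝ × ℝ → E →L[ℂ] FunSpace := fun e q =>
    ((fderiv ℂ F (e, cm q)).comp (ContinuousLinearMap.inl ℂ E (ℂ × ℂ))).smulRight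
      (FunSpace.cauchyKernel (kq q))
  have hGcont {e : E} (he : ∀ p ∈ K, (e, p) ∈ O) : Continuous (G e) :=
    (hF.continuousOn.comp_continuous (continuous_const.prodMk hcm)
      fun q => he _ (hcmK q)).smul hker
  have hG'cont {e : E} (he : ∀ p ∈ K, (e, p) ∈ O) : Continuous (G' e) := by
    have h1 : Continuous fun q => fderiv ℂ F (e, cm q) :=
      hfd.comp_continuous (continuous_const.prodMk hcm) fun q => he _ (hcmK q)
    have h2 : Continuous fun q => (fderiv ℂ F (e, cm q)).comp
      (ContinuousLinearMap.inl ℂ E (ℂ × ℂ)) := h1.clm_comp continuous_const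
    exact ((ContinuousLinearMap.smulRightL ℂ E FunSpace).continuous.comp h2).clm_apply hker
  have hG' {e : E} (he : ∀ p ∈ K, (e, p) ∈ O) (q : ℝ × ℝ) :
      HasFDerivAt (fun e => G e q) (G' e q) e := by
    have h1 : HasFDerivAt (fun e => F (e, cm q))
        ((fderiv ℂ F (e, cm q)).comp (ContinuousLinearMap.inl ℂ E (ℂ × ℂ))) e :=
      (hdiff (he _ (hcmK q))).hasFDerivAt.comp e (hasFDerivAt_prodMk_left e (cm q))
    exact h1.smul_const _
  have hV₀ : ∀ p ∈ K, (e₀, p) ∈ O := hV.self_of_nhds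
  obtain ⟨B, hB⟩ := hT.exists_bound_of_continuousOn hker.continuousOn
  have hB0 : 0 ≤ B := (norm_nonneg _).trans
    (hB (0, 0) ⟨by simp [Real.pi_pos.le], by simp [Real.pi_pos.le]⟩)
  have hmain : HasFDerivAt (fun e => ∫ q in T, G e q) (∫ q in T, G' e₀ q) e₀ := by
    refine hasFDerivAt_integral_of_dominated_of_fderiv_le (hV.and hC)
      (hV.mono fun e he => (hGcont he).aestronglyMeasurable)
      ((hGcont hV₀).continuousOn.integrableOn_compact hT)
      (hG'cont hV₀).aestronglyMeasurable (bound := fun _ => C * B) ?_ ?_ ?_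
    · refine (ae_restrict_iff' hT.measurableSet).2 (Eventually.of_forall fun q hq e he => ?_)
      have h1 : ‖(fderiv ℂ F (e, cm q)).comp (ContinuousLinearMap.inl ℂ E (ℂ × ℂ))‖ ≤ C := by
        refine (ContinuousLinearMap.opNorm_comp_le _ _).trans ?_
        refine (mul_le_of_le_one_right (norm_nonneg _)
          (ContinuousLinearMap.norm_inl_le_one ℂ E (ℂ × ℂ))).trans (he.2 _ (hcmK q))
      have h2 := hB q hq
      simp only [G', ContinuousLinearMap.norm_smulRight_apply]
      exact mul_le_mul h1 h2 (norm_nonneg _) ((norm_nonneg _).trans h1)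
    · exact integrableOn_const hT.measure_lt_top.ne
    · exact Eventually.of_forall fun q e he => hG' he.1 q
  refine ⟨fun e => ((2 * Real.pi : ℂ) ^ 2)⁻¹ • ∫ q in T, G e q,
    hmain.differentiableAt.fun_const_smul _, ?_⟩
  filter_upwards [hV] with e he p hp
  have hOe : IsOpen {p : ℂ × ℂ | (e, p) ∈ O} :=
    hO.preimage (by fun_prop : Continuous fun p : ℂ × ℂ => (e, p))
  have h1 := cauchy_formula_polydisk (f := fun p => F (e, p)) hR0 hOe (fun p hp => he p hp)
    (fun z hz => ((hdiff hz).comp z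
      (by fun_prop : DifferentiableAt ℂ (fun p => (e, p)) z)).differentiableWithinAt)
    (hp.trans hR)
  have hpi : (2 * Real.pi : ℂ) ^ 2 ≠ 0 := by
    have := Real.pi_ne_zero
    norm_cast
    positivity
  rw [← FunSpace.evalL_apply hp, map_smul,
    ← ContinuousLinearMap.integral_comp_comm _
      ((hGcont he).continuousOn.integrableOn_compact hT), smul_eq_mul, inv_mul_eq_iff_eq_mul₀ hpi,
    ← h1]
  refine integral_congr_ae (Eventually.of_forall fun q => ?_)
  have h2 := FunSpace.evalL_cauchyKernel hp ((hkq q).trans_lt hlt)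
  have h3 : (rho : ℂ) ≠ 0 := rho_ne_zero
  simp only [G, map_smul, smul_eq_mul, h2, kq, cm]
  have h4 (w z : ℂ) : rho / z * w / rho = w / z := by field_simp
  rw [h4, h4]

/-! ### The symmetric subspace -/

/-- The terms `n (q/ρ)^n` are bounded by their finite sum. The factor produced by differentiation is
thus absorbed by shrinking the radius. -/
theorem exists_natCast_mul_pow_le {q : ℝ} (hq : 0 < q) (hqr : q < rho) :
    ∃ K : ℝ, 0 ≤ K ∧ ∀ i : ℕ, (i : ℝ) * q ^ (i - 1) ≤ K * rho ^ i := by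
  have hθ0 : 0 ≤ q / rho := (div_pos hq rho_pos).le
  have hθ : ‖q / rho‖ < 1 := by
    rw [Real.norm_eq_abs, abs_of_nonneg hθ0, div_lt_one rho_pos]; exact hqr
  have hs : Summable fun n : ℕ => (n : ℝ) * (q / rho) ^ n := by
    simpa using summable_pow_mul_geometric_of_norm_lt_one 1 hθ
  have hnn (n : ℕ) : 0 ≤ (n : ℝ) * (q / rho) ^ n := by positivity
  refine ⟨(∑' n : ℕ, (n : ℝ) * (q / rho) ^ n) / q, div_nonneg (tsum_nonneg hnn) hq.le,
    fun i => ?_⟩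
  have h1 := hs.le_tsum i fun j _ => hnn j
  have h2 : 0 < rho ^ i := pow_pos rho_pos i
  have h3 : (i : ℝ) * q ^ (i - 1) = (i : ℝ) * (q / rho) ^ i / q * rho ^ i := by
    rcases i with _ | i
    · simp
    · have := rho_pos.ne'
      rw [Nat.add_sub_cancel, div_pow, pow_succ q]
      field_simp
  rw [h3]
  gcongr

namespace FunSpace

/-- The coefficients of `∂₁ s`. -/
noncomputable def derivCoeff (s : FunSpace) (p : ℕ × ℕ) : ℂ :=
  ((p.1 : ℂ) + 1) * s.coeff (p.1 + 1) p.2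

theorem summable_derivCoeff (s : FunSpace) {q : ℝ} (hq : 0 < q) (hqr : q < rho) :
    Summable fun p : ℕ × ℕ => ‖s.derivCoeff p‖ * q ^ (p.1 + p.2) := by
  obtain ⟨K, hK0, hK⟩ := exists_natCast_mul_pow_le hq hqr
  have hinj : Function.Injective fun p : ℕ × ℕ => (p.1 + 1, p.2) := fun p q h => by
    simpa [Prod.ext_iff] using h
  refine Summable.of_nonneg_of_le (fun p => by positivity) (fun p => ?_)
    ((s.summable_coeff.comp_injective hinj).mul_left K)
  have h1 := hK (p.1 + 1)
  simp only [Nat.add_sub_cancel, Nat.cast_add, Nat.cast_one] at h1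
  have h2 : ‖(p.1 : ℂ) + 1‖ = (p.1 : ℝ) + 1 := by
    have : ((p.1 : ℂ) + 1) = ((p.1 + 1 : ℕ) : ℂ) := by push_cast; ring
    rw [this, Complex.norm_natCast]; push_cast; ring
  rw [derivCoeff, norm_mul, h2, pow_add]
  simp only [Function.comp, pow_add _ (p.1 + 1)]
  have h3 : q ^ p.2 ≤ rho ^ p.2 := pow_le_pow_left₀ hq.le hqr.le _
  have h4 : 0 ≤ K * rho ^ (p.1 + 1) := mul_nonneg hK0 (pow_pos rho_pos _).le
  calc ((p.1 : ℝ) + 1) * ‖s.coeff (p.1 + 1) p.2‖ * (q ^ p.1 * q ^ p.2)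
      = ‖s.coeff (p.1 + 1) p.2‖ * ((((p.1 : ℝ) + 1) * q ^ p.1) * q ^ p.2) := by ring
    _ ≤ ‖s.coeff (p.1 + 1) p.2‖ * ((K * rho ^ (p.1 + 1)) * rho ^ p.2) := by gcongr
    _ = _ := by ring

theorem hasDerivAt_eval_fst (s : FunSpace) {x y : ℂ} (hx : ‖x‖ < rho) (hy : ‖y‖ < rho) :
    HasDerivAt (fun x => s.eval x y) (∑' p : ℕ × ℕ, s.derivCoeff p * x ^ p.1 * y ^ p.2) x := by
  obtain ⟨q, hxq, hqr⟩ := exists_between hx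
  have hq : 0 < q := (norm_nonneg x).trans_lt hxq
  obtain ⟨K, hK0, hK⟩ := exists_natCast_mul_pow_le hq hqr
  have h1 := hasDerivAt_tsum_of_isPreconnected
    (g := fun (p : ℕ × ℕ) (x : ℂ) => s.coeff p.1 p.2 * x ^ p.1 * y ^ p.2)
    (g' := fun (p : ℕ × ℕ) (x : ℂ) => s.coeff p.1 p.2 * (p.1 * x ^ (p.1 - 1)) * y ^ p.2)
    (s.summable_coeff.mul_left K) (isOpen_ball : IsOpen (ball (0 : ℂ) q))
    (convex_ball (0 : ℂ) q).isPreconnected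
    (fun p z _ => ((hasDerivAt_pow p.1 z).const_mul _).mul_const _)
    (fun p z hz => ?_) (y := x) (by simpa using hxq)
    (summable_powerSeries₂ s.summable_coeff hx.le hy.le) (by simpa using hxq)
  · convert! h1 using 1
    have hinj : Function.Injective fun p : ℕ × ℕ => (p.1 + 1, p.2) := fun p q h => by
      simpa [Prod.ext_iff] using h
    rw [← hinj.tsum_eq (f := fun p : ℕ × ℕ => s.coeff p.1 p.2 * (p.1 * x ^ (p.1 - 1)) * y ^ p.2)]
    · refine tsum_congr fun p => ?_
      simp only [derivCoeff, Nat.add_sub_cancel]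
      push_cast
      ring
    · rintro ⟨i, j⟩ h
      rcases i with _ | i
      · simp at h
      · exact ⟨(i, j), rfl⟩
  · have hz' : ‖z‖ ≤ q := by simpa using (mem_ball_zero_iff.1 hz).le
    rw [norm_mul, norm_mul, norm_mul, norm_pow, norm_pow, Complex.norm_natCast]
    have h2 : (p.1 : ℝ) * ‖z‖ ^ (p.1 - 1) ≤ K * rho ^ p.1 :=
      (by gcongr : (p.1 : ℝ) * ‖z‖ ^ (p.1 - 1) ≤ p.1 * q ^ (p.1 - 1)).trans (hK p.1)
    calc ‖s.coeff p.1 p.2‖ * ((p.1 : ℝ) * ‖z‖ ^ (p.1 - 1)) * ‖y‖ ^ p.2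
        ≤ ‖s.coeff p.1 p.2‖ * (K * rho ^ p.1) * rho ^ p.2 := by
          have := rho_pos
          gcongr
      _ = _ := by rw [pow_add]; ring

theorem tsum_derivCoeff_swap (s : FunSpace) (x y : ℂ) :
    ∑' p : ℕ × ℕ, s.derivCoeff p * y ^ p.1 * x ^ p.2 =
      ∑' p : ℕ × ℕ, s.derivCoeff p.swap * x ^ p.1 * y ^ p.2 := by
  rw [← (Equiv.prodComm ℕ ℕ).tsum_eq]
  refine tsum_congr fun p => ?_
  simp only [Equiv.prodComm_apply, Prod.fst_swap, Prod.snd_swap]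
  ring

/-- Uniqueness of coefficients for the series of `∂₁s(x,y) - ∂₁s(y,x)`. The radius `ρ/2` serves
because the differentiated series need not be summable at `ρ`. -/
theorem mem_symSubmodule_of_deriv {s : FunSpace}
    (h : ∀ x y : ℂ, ‖x‖ < rho → ‖y‖ < rho →
      deriv (fun x' => s.eval x' y) x = deriv (fun x' => s.eval x' x) y) :
    s ∈ symSubmodule := by
  intro i j
  have hq : 0 < rho / 2 := half_pos rho_pos
  have hqr : rho / 2 < rho := half_lt_self rho_pos
  have hsum := s.summable_derivCoeff hq hqr
  have hsum' : Summable fun p : ℕ × ℕ => ‖s.derivCoeff p.swap‖ * (rho / 2) ^ (p.1 + p.2) := by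
    refine ((Equiv.prodComm ℕ ℕ).summable_iff.2 hsum).congr fun p => ?_
    simp [add_comm]
  have key := powerSeries₂_coeff_eq_zero (c := fun p => s.derivCoeff p - s.derivCoeff p.swap) hq
    (Summable.of_nonneg_of_le (fun p => by positivity) (fun p => by
      rw [← add_mul]
      gcongr
      exact norm_sub_le _ _) (hsum.add hsum')) (fun x y hx hy => ?_) (i, j)
  · exact sub_eq_zero.1 key
  · have h1 := h x y (hx.trans hqr) (hy.trans hqr)
    rw [(s.hasDerivAt_eval_fst (hx.trans hqr) (hy.trans hqr)).deriv,
      (s.hasDerivAt_eval_fst (hy.trans hqr) (hx.trans hqr)).deriv, tsum_derivCoeff_swap s x y,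
      ← sub_eq_zero, ← (summable_powerSeries₂ hsum hx.le hy.le).tsum_sub
        (summable_powerSeries₂ (c := fun p => s.derivCoeff p.swap) hsum' hx.le hy.le)] at h1
    rw [← h1]
    refine tsum_congr fun p => ?_
    ring

end FunSpace

theorem deriv_ev_symm (s : SymSpace) {x y : ℂ} (hx : ‖x‖ < rho) (hy : ‖y‖ < rho) :
    deriv (fun x' => ev s x' y) x = deriv (fun x' => ev s x' x) y := by
  have h1 : deriv (fun x' => ev s x' y) x = _ := (s.1.hasDerivAt_eval_fst hx hy).deriv
  have h2 : deriv (fun x' => ev s x' x) y = _ := (s.1.hasDerivAt_eval_fst hy hx).deriv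
  rw [h1, h2, FunSpace.tsum_derivCoeff_swap _ x y]
  refine tsum_congr fun p => ?_
  congr 2
  exact s.2 p.1 p.2

/-- Difference quotients stay in the closed subspace, hence so does the derivative, and the
remainder estimate is unchanged. -/
theorem Submodule.differentiableAt_of_coe {E F : Type*} [NormedAddCommGroup E] [NormedSpace ℂ E]
    [NormedAddCommGroup F] [NormedSpace ℂ F] {S : Submodule ℂ F} (hS : IsClosed (S : Set F))
    {f : E → S} {a : E} (hf : DifferentiableAt ℂ (fun e => (f e : F)) a) :
    DifferentiableAt ℂ f a := by
  obtain ⟨D, hD⟩ := hf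
  have hmem (v : E) : D v ∈ S := by
    have h1 : HasDerivAt (fun t : ℂ => (f (a + t • v) : F)) (D v) 0 := by
      have h2 : HasDerivAt (fun t : ℂ => a + t • v) v 0 := by
        simpa using ((hasDerivAt_id (0 : ℂ)).smul_const v).const_add a
      have h3 : HasFDerivAt (fun e => (f e : F)) D (a + (0 : ℂ) • v) := by simpa using hD
      exact h3.comp_hasDerivAt 0 h2
    refine hS.mem_of_tendsto (hasDerivAt_iff_tendsto_slope.1 h1) (Eventually.of_forall fun t => ?_)
    exact S.smul_mem _ (S.sub_mem (f _).2 (f _).2)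
  refine ⟨D.codRestrict S hmem, ?_⟩
  rw [hasFDerivAt_iff_isLittleO] at hD ⊢
  exact Asymptotics.isLittleO_norm_left.1 (Asymptotics.isLittleO_norm_left.2 hD :)

/-! ### Evaluation as a smooth function, the midpoint branch and the prerenormalization -/

/-- The equivalence includes local uniqueness, which identifies a given continuous branch of
solutions with the smooth one. -/
theorem exists_implicit {E : Type*} [NormedAddCommGroup E] [NormedSpace ℂ E] [CompleteSpace E]
    {M : E × ℂ → ℂ} {n : WithTop ℕ∞} (hn : n ≠ 0) {u : E × ℂ} (hM : ContDiffAt ℂ n M u)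
    (hd : fderiv ℂ M u (0, 1) ≠ 0) :
    ∃ f : E → ℂ, ContDiffAt ℂ n f u.1 ∧ ∀ᶠ v in 𝓝 u, M v = M u ↔ f v.1 = v.2 := by
  have hinv : (fderiv ℂ M u ∘L .inr ℂ E ℂ).IsInvertible := by
    refine ⟨ContinuousLinearEquiv.unitsEquivAut ℂ (Units.mk0 _ hd), ?_⟩
    ext
    simp
  exact ⟨hM.implicitFunction hn hinv, hM.contDiffAt_implicitFunction hn hinv,
    hM.eventually_apply_eq_iff_implicitFunction hn hinv⟩

/-- Evaluation at `p` as a functional on the symmetric space. -/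
noncomputable def evL (p : ℂ × ℂ) : SymSpace →L[ℂ] ℂ :=
  (FunSpace.evalL p).comp symSubmodule.subtypeL

theorem evL_apply {p : ℂ × ℂ} (hp : ‖p‖ < rho) (s : SymSpace) : evL p s = ev s p.1 p.2 :=
  FunSpace.evalL_apply hp s.1

theorem norm_mk_lt {x y : ℂ} {r : ℝ} (hx : ‖x‖ < r) (hy : ‖y‖ < r) : ‖((x, y) : ℂ × ℂ)‖ < r := by
  simp [Prod.norm_def, hx, hy]

theorem SymSpace.ext_ev {s t : SymSpace} (h : ∀ p : ℂ × ℂ, ‖p‖ < rho → ev s p.1 p.2 = ev t p.1 p.2) :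
    s = t :=
  Subtype.ext (FunSpace.eq_of_eval_eq fun p hp => h p (mem_bidisk_iff.1 hp))

/-- The value `s(x, y)` as a function on the product. -/
noncomputable def evUncurried (q : SymSpace × (ℂ × ℂ)) : ℂ := ev q.1 q.2.1 q.2.2

/-- Evaluation is the continuous bilinear pairing of `s` with `evL p`, and `evL` is smooth in `p`.
-/
theorem contDiffAt_ev {n : WithTop ℕ∞} {q : SymSpace × (ℂ × ℂ)} (hq : ‖q.2‖ < rho) :
    ContDiffAt ℂ n evUncurried q := by
  have h1 : ContDiffAt ℂ n (fun q : SymSpace × (ℂ × ℂ) => evL q.2 q.1) q := by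
    refine ContDiffAt.clm_apply ?_ contDiffAt_fst
    exact ((FunSpace.contDiffAt_evalL hq).comp q contDiffAt_snd).clm_comp contDiffAt_const
  refine h1.congr_of_eventuallyEq ?_
  filter_upwards [(isOpen_lt (by fun_prop : Continuous fun q : SymSpace × (ℂ × ℂ) => ‖q.2‖)
    continuous_const).mem_nhds hq] with q' hq'
  exact (evL_apply hq' _).symm

/-- The partial derivative `∂₁ s (x, y)`. -/
noncomputable def evD₁ (s : SymSpace) (x y : ℂ) : ℂ := deriv (fun x' => ev s x' y) x

/-- The partial derivative `∂₂ s (x, y)`. -/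
noncomputable def evD₂ (s : SymSpace) (x y : ℂ) : ℂ := deriv (fun y' => ev s x y') y

theorem evD₁_symm (s : SymSpace) {x y : ℂ} (hx : ‖x‖ < rho) (hy : ‖y‖ < rho) :
    evD₁ s x y = evD₁ s y x := deriv_ev_symm s hx hy

theorem differentiableAt_ev_fst (s : SymSpace) {x y : ℂ} (hx : ‖x‖ < rho) (hy : ‖y‖ < rho) :
    DifferentiableAt ℂ (fun x' => ev s x' y) x :=
  ((contDiffAt_ev (n := 1) (q := (s, (x, y))) (norm_mk_lt hx hy)).differentiableAt
    one_ne_zero).fun_comp' x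
    (by fun_prop : DifferentiableAt ℂ (fun x' : ℂ => (s, (x', y))) x)

theorem differentiableAt_ev_snd (s : SymSpace) {x y : ℂ} (hx : ‖x‖ < rho) (hy : ‖y‖ < rho) :
    DifferentiableAt ℂ (fun y' => ev s x y') y :=
  DifferentiableAt.fun_comp' (g := evUncurried) (f := fun y' : ℂ => (s, (x, y'))) y
    ((contDiffAt_ev (n := 1) (q := (s, (x, y))) (norm_mk_lt hx hy)).differentiableAt one_ne_zero)
    (by fun_prop : DifferentiableAt ℂ (fun y' : ℂ => (s, (x, y'))) y)

theorem fderiv_ev (s : SymSpace) {x y : ℂ} (hx : ‖x‖ < rho) (hy : ‖y‖ < rho)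
    (v : SymSpace) (h k : ℂ) :
    fderiv ℂ evUncurried (s, (x, y)) (v, (h, k)) =
      ev v x y + h * evD₁ s x y + k * evD₂ s x y := by
  have hp := norm_mk_lt hx hy
  have hQ := ((contDiffAt_ev (n := 1) (q := (s, (x, y))) hp).differentiableAt
    one_ne_zero).hasFDerivAt
  set D := fderiv ℂ evUncurried (s, (x, y)) with hD
  have h1 : D (v, 0) = ev v x y := by
    have h2 : HasFDerivAt (fun s' : SymSpace => ev s' x y) (D.comp (.inl ℂ _ _)) s :=
      HasFDerivAt.comp (g := evUncurried) (f := fun s' => (s', (x, y))) s hQ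
        (hasFDerivAt_prodMk_left s (x, y))
    have h3 : HasFDerivAt (fun s' : SymSpace => ev s' x y) (evL (x, y)) s :=
      (evL (x, y)).hasFDerivAt.congr_of_eventuallyEq
        (Eventually.of_forall fun s' => (evL_apply hp s').symm)
    have h4 := DFunLike.congr_fun (h2.unique h3) v
    rw [evL_apply hp] at h4
    simpa using h4
  have h2 : D (0, (1, 0)) = evD₁ s x y := by
    have h3 : HasDerivAt (fun x' : ℂ => ((s, (x', y)) : SymSpace × (ℂ × ℂ))) (0, (1, 0)) x :=
      (hasDerivAt_const x s).prodMk ((hasDerivAt_id x).prodMk (hasDerivAt_const x y))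
    exact (hQ.comp_hasDerivAt x h3).deriv.symm
  have h3 : D (0, (0, 1)) = evD₂ s x y := by
    have h3 : HasDerivAt (fun y' : ℂ => ((s, (x, y')) : SymSpace × (ℂ × ℂ))) (0, (0, 1)) y :=
      (hasDerivAt_const y s).prodMk ((hasDerivAt_const y x).prodMk (hasDerivAt_id y))
    exact (hQ.comp_hasDerivAt y h3).deriv.symm
  have h4 : ((v, (h, k)) : SymSpace × (ℂ × ℂ)) =
      (v, 0) + h • (0, (1, 0)) + k • (0, (0, 1)) := by
    ext <;> simp
  rw [h4, map_add, map_add, map_smul, map_smul, h1, h2, h3, smul_eq_mul, smul_eq_mul]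

/-- The chain rule for `e ↦ s(e)(x(e), y(e))`. -/
theorem hasFDerivAt_ev_comp {E : Type*} [NormedAddCommGroup E] [NormedSpace ℂ E] {e : E}
    {s : E → SymSpace} {x y : E → ℂ} {s' : E →L[ℂ] SymSpace} {x' y' : E →L[ℂ] ℂ}
    (hs : HasFDerivAt s s' e) (hx : HasFDerivAt x x' e) (hy : HasFDerivAt y y' e)
    (hxe : ‖x e‖ < rho) (hye : ‖y e‖ < rho) :
    HasFDerivAt (fun e => ev (s e) (x e) (y e)) ((evL (x e, y e)).comp s' +
      evD₁ (s e) (x e) (y e) • x' + evD₂ (s e) (x e) (y e) • y') e := by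
  have hp := norm_mk_lt hxe hye
  have hQ := ((contDiffAt_ev (n := 1) (q := (s e, (x e, y e))) hp).differentiableAt
    one_ne_zero).hasFDerivAt
  have h1 := HasFDerivAt.comp e (f := fun e => (s e, (x e, y e))) hQ (hs.prodMk (hx.prodMk hy))
  refine h1.congr_fderiv ?_
  ext v
  simp only [ContinuousLinearMap.comp_apply, ContinuousLinearMap.prod_apply,
    add_apply, smul_apply, smul_eq_mul, evL_apply hp]
  rw [fderiv_ev _ hxe hye]
  ring

/-- The prerenormalization as a function on the product. -/
noncomputable def preUncurried (Z : SymSpace → ℂ × ℂ → ℂ) (q : SymSpace × (ℂ × ℂ)) : ℂ :=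
  preEKW Z q.1 q.2.1 q.2.2

namespace IsMidpointBranch

variable {U : Set SymSpace} {r : ℝ} {Z : SymSpace → ℂ × ℂ → ℂ}

theorem lt_rho (hZ : IsMidpointBranch U r Z) {p : ℂ × ℂ} (hp : ‖p‖ < r) :
    ‖p.1‖ < rho ∧ ‖p.2‖ < rho :=
  ⟨(norm_fst_le p).trans_lt (hp.trans_le hZ.r_le), (norm_snd_le p).trans_lt (hp.trans_le hZ.r_le)⟩

theorem eventually_mem (hU : IsOpen U) {q : SymSpace × (ℂ × ℂ)} (hs : q.1 ∈ U) (hp : ‖q.2‖ < r) :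
    ∀ᶠ q' in 𝓝 q, q'.1 ∈ U ∧ ‖q'.2‖ < r :=
  (hU.preimage continuous_fst).inter (isOpen_lt (continuous_norm.comp continuous_snd)
    continuous_const) |>.mem_nhds ⟨hs, hp⟩

theorem deriv_ne_zero (hZ : IsMidpointBranch U r Z) {s : SymSpace} (hs : s ∈ U) {p : ℂ × ℂ}
    (hp : ‖p‖ < r) : evD₂ s p.1 (Z s p) + evD₂ s p.2 (Z s p) ≠ 0 := by
  have hp' := mem_bidisk_iff.2 hp
  have h1 := hZ.simple s hs p hp'
  have hz := hZ.norm_lt s hs p hp'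
  rwa [deriv_fun_add (differentiableAt_ev_snd s (hZ.lt_rho hp).1 hz)
    (differentiableAt_ev_snd s (hZ.lt_rho hp).2 hz)] at h1

theorem exists_local (hZ : IsMidpointBranch U r Z) {s : SymSpace} (hs : s ∈ U) {p : ℂ × ℂ}
    (hp : ‖p‖ < r) : ∃ f : SymSpace × (ℂ × ℂ) → ℂ, ContDiffAt ℂ ω f (s, p) ∧
      ∀ᶠ v in 𝓝 ((s, p), Z s p), ev v.1.1 v.1.2.1 v.2 + ev v.1.1 v.1.2.2 v.2 = 0 ↔ f v.1 = v.2 := by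
  have hp' := mem_bidisk_iff.2 hp
  have hz := hZ.norm_lt s hs p hp'
  have hx := (hZ.lt_rho hp).1
  have hy := (hZ.lt_rho hp).2
  let M : (SymSpace × (ℂ × ℂ)) × ℂ → ℂ :=
    fun v => ev v.1.1 v.1.2.1 v.2 + ev v.1.1 v.1.2.2 v.2
  have hM : ContDiffAt ℂ ω M ((s, p), Z s p) := by
    refine ContDiffAt.add ?_ ?_
    · exact ContDiffAt.comp (g := evUncurried)
        (f := fun v : (SymSpace × (ℂ × ℂ)) × ℂ => (v.1.1, (v.1.2.1, v.2))) _
        (contDiffAt_ev (norm_mk_lt hx hz)) (by fun_prop)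
    · exact ContDiffAt.comp (g := evUncurried)
        (f := fun v : (SymSpace × (ℂ × ℂ)) × ℂ => (v.1.1, (v.1.2.2, v.2))) _
        (contDiffAt_ev (norm_mk_lt hy hz)) (by fun_prop)
  have hd : fderiv ℂ M ((s, p), Z s p) (0, 1) ≠ 0 := by
    have h1 : HasDerivAt (fun z : ℂ => (((s, p), z) : (SymSpace × (ℂ × ℂ)) × ℂ)) (0, 1) (Z s p) :=
      (hasDerivAt_const _ (s, p)).prodMk (hasDerivAt_id _)
    have h2 := HasFDerivAt.comp_hasDerivAt (Z s p)
      (hM.differentiableAt (by simp)).hasFDerivAt h1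
    rw [← h2.deriv]
    exact hZ.simple s hs p hp'
  obtain ⟨f, hf, h⟩ := exists_implicit (by simp) hM hd
  refine ⟨f, hf, ?_⟩
  have h0 : M ((s, p), Z s p) = 0 := hZ.midpoint s hs p hp'
  simpa only [h0] using h

theorem continuousAt (hZ : IsMidpointBranch U r Z) (hU : IsOpen U) {q : SymSpace × (ℂ × ℂ)}
    (hs : q.1 ∈ U) (hp : ‖q.2‖ < r) :
    ContinuousAt (fun q : SymSpace × (ℂ × ℂ) => Z q.1 q.2) q :=
  hZ.cont.continuousAt ((hU.prod (isOpen_bidisk r)).mem_nhds ⟨hs, mem_bidisk_iff.2 hp⟩)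

/-- Continuity keeps `Z` where the simple root is locally unique, so `Z` coincides there with the
implicit function. -/
theorem contDiffAt (hZ : IsMidpointBranch U r Z) (hU : IsOpen U) {q : SymSpace × (ℂ × ℂ)}
    (hs : q.1 ∈ U) (hp : ‖q.2‖ < r) :
    ContDiffAt ℂ ω (fun q : SymSpace × (ℂ × ℂ) => Z q.1 q.2) q := by
  obtain ⟨f, hf, h⟩ := hZ.exists_local hs hp
  refine hf.congr_of_eventuallyEq ?_
  have hc : ContinuousAt (fun q : SymSpace × (ℂ × ℂ) => (q, Z q.1 q.2)) q :=
    continuousAt_id.prodMk (hZ.continuousAt hU hs hp)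
  filter_upwards [hc.eventually h, eventually_mem hU hs hp] with q' h1 h2
  exact (h1.1 (hZ.midpoint _ h2.1 _ (mem_bidisk_iff.2 h2.2))).symm

/-- The midpoint is symmetric in its two arguments. -/
theorem symm (hZ : IsMidpointBranch U r Z) (hU : IsOpen U) {s : SymSpace} (hs : s ∈ U)
    {p : ℂ × ℂ} (hp : ‖p‖ < r) : Z s p.swap = Z s p := by
  have hswap (p : ℂ × ℂ) : ‖p.swap‖ = ‖p‖ := by simp [Prod.norm_def, max_comm]
  have han : AnalyticOnNhd ℂ (fun p : ℂ × ℂ => Z s p) (ball 0 r) := fun p hp => by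
    have h1 := hZ.contDiffAt hU (q := (s, p)) hs (by simpa using hp)
    exact (ContDiffAt.comp p h1 (by fun_prop : ContDiffAt ℂ ω (fun p => (s, p)) p)).analyticAt
  have han' : AnalyticOnNhd ℂ (fun p : ℂ × ℂ => Z s p.swap) (ball 0 r) := fun p hp => by
    have h1 := hZ.contDiffAt hU (q := (s, p.swap)) hs (by simpa [hswap] using hp)
    exact (ContDiffAt.comp p h1
      (by simp only [Prod.swap]; fun_prop :
        ContDiffAt ℂ ω (fun p : ℂ × ℂ => (s, p.swap)) p)).analyticAt
  have h0 : ‖(0 : ℂ × ℂ)‖ < r := by simpa using hZ.r_pos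
  -- The origin is fixed by the swap, so both branches start from the same root and agree near it by
  -- local uniqueness. Analytic continuation extends this to the whole polydisk.
  have hev : (fun p : ℂ × ℂ => Z s p.swap) =ᶠ[𝓝 0] fun p => Z s p := by
    obtain ⟨f, -, h⟩ := hZ.exists_local hs h0
    have hc : ContinuousAt (fun p : ℂ × ℂ => ((s, p), Z s p)) 0 :=
      (by fun_prop : ContinuousAt (fun p : ℂ × ℂ => (s, p)) 0).prodMk
        (han 0 (by simpa using hZ.r_pos)).continuousAt
    have hc' : ContinuousAt (fun p : ℂ × ℂ => ((s, p), Z s p.swap)) 0 :=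
      (by fun_prop : ContinuousAt (fun p : ℂ × ℂ => (s, p)) 0).prodMk
        (han' 0 (by simpa using hZ.r_pos)).continuousAt
    filter_upwards [hc.eventually h, hc'.eventually h, ball_mem_nhds 0 hZ.r_pos] with p h1 h2 h3
    have h4 := hZ.midpoint s hs p (by rw [bidisk_eq_ball]; exact h3)
    have h5 := hZ.midpoint s hs p.swap (mem_bidisk_iff.2 (by simpa [hswap] using h3))
    exact (h2.1 (by rw [add_comm]; exact h5)).symm.trans (h1.1 h4)
  exact han'.eqOn_of_preconnected_of_eventuallyEq han (convex_ball _ _).isPreconnected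
    (by simpa using hZ.r_pos) hev (by simpa using hp)

/-- The derivative of the midpoint equation. -/
theorem fderiv_eq (hZ : IsMidpointBranch U r Z) (hU : IsOpen U) {s : SymSpace} (hs : s ∈ U)
    {p : ℂ × ℂ} (hp : ‖p‖ < r) (v : SymSpace) (h k : ℂ) :
    ev v p.1 (Z s p) + ev v p.2 (Z s p) + h * evD₁ s p.1 (Z s p) + k * evD₁ s p.2 (Z s p) +
      (evD₂ s p.1 (Z s p) + evD₂ s p.2 (Z s p)) *
        fderiv ℂ (fun q : SymSpace × (ℂ × ℂ) => Z q.1 q.2) (s, p) (v, (h, k)) = 0 := by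
  have hz := hZ.norm_lt s hs p (mem_bidisk_iff.2 hp)
  have hx := (hZ.lt_rho hp).1
  have hy := (hZ.lt_rho hp).2
  have hD := ((hZ.contDiffAt hU (q := (s, p)) hs hp).differentiableAt (by simp)).hasFDerivAt
  set D := fderiv ℂ (fun q : SymSpace × (ℂ × ℂ) => Z q.1 q.2) (s, p)
  have h1 := hasFDerivAt_ev_comp (e := (s, p)) (hasFDerivAt_fst (𝕜 := ℂ))
    ((hasFDerivAt_fst (𝕜 := ℂ)).comp (s, p) (hasFDerivAt_snd (𝕜 := ℂ))) hD hx hz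
  have h2 := hasFDerivAt_ev_comp (e := (s, p)) (hasFDerivAt_fst (𝕜 := ℂ))
    ((hasFDerivAt_snd (𝕜 := ℂ)).comp (s, p) (hasFDerivAt_snd (𝕜 := ℂ))) hD hy hz
  have h3 := (h1.add h2).congr_of_eventuallyEq (f₁ := fun _ => (0 : ℂ)) (by
    filter_upwards [eventually_mem hU (q := (s, p)) hs hp] with q hq
    exact (hZ.midpoint _ hq.1 _ (mem_bidisk_iff.2 hq.2)).symm)
  have h4 := DFunLike.congr_fun (h3.unique (hasFDerivAt_const (0 : ℂ) (s, p))) (v, (h, k))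
  simp only [add_apply, smul_apply, smul_eq_mul, ContinuousLinearMap.comp_apply,
    ContinuousLinearMap.coe_fst', ContinuousLinearMap.coe_snd', Function.comp,
    evL_apply (norm_mk_lt hx hz), evL_apply (norm_mk_lt hy hz), zero_apply] at h4
  rw [← h4]
  ring

theorem contDiffAt_pre (hZ : IsMidpointBranch U r Z) (hU : IsOpen U) {q : SymSpace × (ℂ × ℂ)}
    (hs : q.1 ∈ U) (hp : ‖q.2‖ < r) : ContDiffAt ℂ ω (preUncurried Z) q :=
  ContDiffAt.comp (g := evUncurried)
    (f := fun q : SymSpace × (ℂ × ℂ) => (q.1, (Z q.1 q.2, q.2.2))) q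
    (contDiffAt_ev (norm_mk_lt (hZ.norm_lt _ hs _ (mem_bidisk_iff.2 hp)) (hZ.lt_rho hp).2))
    (contDiffAt_fst.prodMk ((hZ.contDiffAt hU hs hp).prodMk (by fun_prop)))

theorem fderiv_pre (hZ : IsMidpointBranch U r Z) (hU : IsOpen U) {s : SymSpace} (hs : s ∈ U)
    {p : ℂ × ℂ} (hp : ‖p‖ < r) (v : SymSpace) (h k : ℂ) :
    fderiv ℂ (preUncurried Z) (s, p) (v, (h, k)) = ev v (Z s p) p.2 +
      fderiv ℂ (fun q : SymSpace × (ℂ × ℂ) => Z q.1 q.2) (s, p) (v, (h, k)) * evD₁ s (Z s p) p.2 +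
        k * evD₂ s (Z s p) p.2 := by
  have hz := hZ.norm_lt s hs p (mem_bidisk_iff.2 hp)
  have hy := (hZ.lt_rho hp).2
  have hD := ((hZ.contDiffAt hU (q := (s, p)) hs hp).differentiableAt (by simp)).hasFDerivAt
  set D := fderiv ℂ (fun q : SymSpace × (ℂ × ℂ) => Z q.1 q.2) (s, p)
  have h1 := hasFDerivAt_ev_comp (e := (s, p)) (hasFDerivAt_fst (𝕜 := ℂ)) hD
    ((hasFDerivAt_snd (𝕜 := ℂ)).comp (s, p) (hasFDerivAt_snd (𝕜 := ℂ))) hz hy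
  have h2 : fderiv ℂ (preUncurried Z) (s, p) = _ := h1.fderiv
  rw [h2]
  simp only [add_apply, smul_apply, smul_eq_mul, ContinuousLinearMap.comp_apply,
    ContinuousLinearMap.coe_fst', ContinuousLinearMap.coe_snd', Function.comp,
    evL_apply (norm_mk_lt hz hy)]
  ring

/-- The first partial derivative of the prerenormalization is symmetric. -/
theorem fderiv_pre_symm (hZ : IsMidpointBranch U r Z) (hU : IsOpen U) {s : SymSpace} (hs : s ∈ U)
    {x y : ℂ} (hx : ‖x‖ < r) (hy : ‖y‖ < r) :
    fderiv ℂ (preUncurried Z) (s, (x, y)) (0, (1, 0)) =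
      fderiv ℂ (preUncurried Z) (s, (y, x)) (0, (1, 0)) := by
  have hp := norm_mk_lt hx hy
  have hp' := norm_mk_lt hy hx
  have hz := hZ.norm_lt s hs _ (mem_bidisk_iff.2 hp)
  have hsw : Z s (y, x) = Z s (x, y) := hZ.symm hU hs hp
  have h1 := hZ.fderiv_eq hU hs hp 0 1 0
  have h2 := hZ.fderiv_eq hU hs hp' 0 1 0
  have hN := hZ.deriv_ne_zero hs hp
  have h0 (x y : ℂ) : ev 0 x y = 0 := by simp [ev, FunSpace.eval, FunSpace.coeff]
  rw [hZ.fderiv_pre hU hs hp, hZ.fderiv_pre hU hs hp']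
  simp only [hsw, h0, zero_add, add_zero, zero_mul, one_mul] at h1 h2 hN ⊢
  rw [evD₁_symm s hz (hZ.lt_rho hp).2, evD₁_symm s hz (hZ.lt_rho hp').2]
  simp only at h1 h2 hN ⊢
  -- With `z` the midpoint and `N` the nonzero `z`-derivative of the midpoint equation, both sides
  -- equal `-∂₁s(x,z) ∂₁s(y,z) / N`, which is symmetric.
  apply mul_left_cancel₀ hN
  linear_combination evD₁ s y (Z s (x, y)) * h1 - evD₁ s x (Z s (x, y)) * h2

/-- The derivative of the prerenormalization along the infinitesimal coordinate change `ψ`. -/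
theorem fderiv_pre_psi (hZ : IsMidpointBranch U r Z) (hU : IsOpen U) {s : SymSpace} (hs : s ∈ U)
    {w : SymSpace} (hw : ∀ x y : ℂ, ‖x‖ < rho → ‖y‖ < rho → ev w x y = evD₁ s x y * x ^ 2 +
      evD₂ s x y * y ^ 2 + 2 * ev s x y * y - ev s x y - (evD₁ s x y * x + evD₂ s x y * y))
    {x y : ℂ} (hx : ‖x‖ < r) (hy : ‖y‖ < r) :
    fderiv ℂ (preUncurried Z) (s, (x, y)) (w, (0, 0)) =
      fderiv ℂ (preUncurried Z) (s, (x, y)) (0, (x ^ 2 - x, y ^ 2 - y)) +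
        (2 * y - 1) * preUncurried Z (s, (x, y)) := by
  have hp := norm_mk_lt hx hy
  have hz := hZ.norm_lt s hs _ (mem_bidisk_iff.2 hp)
  have hx' : ‖x‖ < rho := (hZ.lt_rho hp).1
  have hy' : ‖y‖ < rho := (hZ.lt_rho hp).2
  have h1 := hZ.fderiv_eq hU hs hp w 0 0
  have h2 := hZ.fderiv_eq hU hs hp 0 (x ^ 2 - x) (y ^ 2 - y)
  have h3 := hZ.midpoint s hs _ (mem_bidisk_iff.2 hp)
  have hN := hZ.deriv_ne_zero hs hp
  have h0 (x y : ℂ) : ev 0 x y = 0 := by simp [ev, FunSpace.eval, FunSpace.coeff]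
  rw [hZ.fderiv_pre hU hs hp, hZ.fderiv_pre hU hs hp]
  simp only [h0, hw _ _ hx' hz, hw _ _ hy' hz, hw _ _ hz hy', preUncurried, preEKW] at h1 h2 h3 hN ⊢
  set z := Z s (x, y)
  set D := fderiv ℂ (fun q : SymSpace × (ℂ × ℂ) => Z q.1 q.2) (s, (x, y))
  -- Changing coordinates in `s` moves the arguments forward and pulls the midpoint back by the same
  -- vector field. The leftover multiplicative term `2z - 1` multiplies the midpoint equation and
  -- vanishes.
  have h4 : D (w, (0, 0)) = D (0, (x ^ 2 - x, y ^ 2 - y)) - (z ^ 2 - z) := by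
    apply mul_left_cancel₀ hN
    linear_combination h1 - h2 - (2 * z - 1) * h3
  rw [h4]
  ring

end IsMidpointBranch

/-! ### Differentiability of the renormalization operators -/

/-- The function `(x, y) ↦ 𝒫(λ x, λ y)` for free parameters `s`, `t`, `λ`. -/
noncomputable def preParam (Z : SymSpace → ℂ × ℂ → ℂ) (q : (SymSpace × (ℂ × ℂ)) × (ℂ × ℂ)) : ℂ :=
  (1 + 2 * q.1.2.1 * (q.1.2.2 * q.2.2)) * preUncurried Z (q.1.1,
    (q.1.2.2 * q.2.1 + q.1.2.1 * (q.1.2.2 * q.2.1) ^ 2,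
      q.1.2.2 * q.2.2 + q.1.2.1 * (q.1.2.2 * q.2.2) ^ 2))

/-- The scaling `μ` for free parameters `s`, `t`, `λ`. -/
noncomputable def muParam (Z : SymSpace → ℂ × ℂ → ℂ) (e : SymSpace × (ℂ × ℂ)) : ℂ :=
  e.2.2 * (fderiv ℂ (preUncurried Z) (e.1, (e.2.2 + e.2.1 * e.2.2 ^ 2, 0)) (0, (1, 0)) *
    (1 + 2 * e.2.1 * e.2.2))

theorem IsMidpointBranch.hasDerivAt_preEKW {U : Set SymSpace} {r : ℝ}
    {Z : SymSpace → ℂ × ℂ → ℂ} (hZ : IsMidpointBranch U r Z) (hU : IsOpen U) {s : SymSpace} (hs : s ∈ U)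
    {x y : ℂ → ℂ} {a x₁ y₁ : ℂ} (hx : HasDerivAt x x₁ a) (hy : HasDerivAt y y₁ a)
    (hxa : ‖x a‖ < r) (hya : ‖y a‖ < r) :
    HasDerivAt (fun z => preEKW Z s (x z) (y z))
      (fderiv ℂ (preUncurried Z) (s, (x a, y a)) (0, (x₁, y₁))) a := by
  have h1 := ((hZ.contDiffAt_pre hU (q := (s, (x a, y a))) hs
    (norm_mk_lt hxa hya)).differentiableAt (by simp)).hasFDerivAt
  exact HasFDerivAt.comp_hasDerivAt (f := fun z => (s, (x z, y z))) a h1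
    ((hasDerivAt_const a s).prodMk (hx.prodMk hy))

theorem clm_split (D : SymSpace × (ℂ × ℂ) →L[ℂ] ℂ) (v : SymSpace) (h k : ℂ) :
    D (v, (h, k)) = D (v, (0, 0)) + h * D (0, (1, 0)) + k * D (0, (0, 1)) := by
  have h1 : ((v, (h, k)) : SymSpace × (ℂ × ℂ)) =
      (v, (0, 0)) + h • (0, (1, 0)) + k • (0, (0, 1)) := by
    ext <;> simp
  rw [h1, map_add, map_add, map_smul, map_smul, smul_eq_mul, smul_eq_mul]

namespace IsScaling

variable {U : Set SymSpace} {r : ℝ} {Z : SymSpace → ℂ × ℂ → ℂ} {t lam : SymSpace → ℂ}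

theorem norm_fst_lt (hR : IsScaling U r Z t lam) (hZ : IsMidpointBranch U r Z) {s : SymSpace}
    (hs : s ∈ U) : ‖((lam s + t s * lam s ^ 2, 0) : ℂ × ℂ)‖ < r := by
  refine norm_mk_lt ?_ (by simpa using hZ.r_pos)
  simpa using hR.domain s hs 1 (by norm_num [rho])

/-- With `t` and `λ` as free parameters the family does not depend on how they vary with `s`. They
can be substituted later, or frozen as in `differentiableAt_preCoeff`. -/
theorem exists_family (hR : IsScaling U r Z t lam) (hZ : IsMidpointBranch U r Z) (hU : IsOpen U)
    {s : SymSpace} (hs : s ∈ U) :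
    ∃ Φ : SymSpace × (ℂ × ℂ) → FunSpace, DifferentiableAt ℂ Φ (s, (t s, lam s)) ∧
      ∀ᶠ e in 𝓝 (s, (t s, lam s)), ∀ p : ℂ × ℂ, ‖p‖ < rho →
        (Φ e).eval p.1 p.2 = preParam Z (e, p) := by
  let sub : (SymSpace × (ℂ × ℂ)) × (ℂ × ℂ) → SymSpace × (ℂ × ℂ) := fun q => (q.1.1,
    (q.1.2.2 * q.2.1 + q.1.2.1 * (q.1.2.2 * q.2.1) ^ 2,
      q.1.2.2 * q.2.2 + q.1.2.1 * (q.1.2.2 * q.2.2) ^ 2))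
  have hsub : ContDiff ℂ 1 sub := by fun_prop
  let V : Set (SymSpace × (ℂ × ℂ)) := U ×ˢ ball 0 r
  have hV : IsOpen V := hU.prod isOpen_ball
  refine exists_differentiableAt_funSpace (F := preParam Z) (O := sub ⁻¹' V)
    (hV.preimage hsub.continuous) (fun p hp => ?_) ?_
  · refine ⟨hs, ?_⟩
    rw [mem_ball_zero_iff]
    exact norm_mk_lt (hR.domain s hs _ ((_root_.norm_fst_le p).trans hp))
      (hR.domain s hs _ ((_root_.norm_snd_le p).trans hp))
  · intro q hq
    refine ContDiffAt.contDiffWithinAt ?_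
    have h1 : ContDiffAt ℂ 1 (preUncurried Z) (sub q) :=
      (hZ.contDiffAt_pre hU hq.1 (by simpa using hq.2)).of_le (by simp)
    have h2 : ContDiffAt ℂ 1 (fun q => preUncurried Z (sub q)) q :=
      ContDiffAt.comp q h1 hsub.contDiffAt
    exact ContDiffAt.mul (by fun_prop) h2


theorem deriv_pre_zero (hR : IsScaling U r Z t lam) (hZ : IsMidpointBranch U r Z) (hU : IsOpen U)
    {s : SymSpace} (hs : s ∈ U) :
    HasDerivAt (fun x => pre Z t s x 0)
      (fderiv ℂ (preUncurried Z) (s, (lam s + t s * lam s ^ 2, 0)) (0, (1, 0)) *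
        (1 + 2 * t s * lam s)) (lam s) := by
  have hx : HasDerivAt (fun x : ℂ => x + t s * x ^ 2) (1 + 2 * t s * lam s) (lam s) := by
    convert! (hasDerivAt_id (lam s)).add ((hasDerivAt_pow 2 (lam s)).const_mul (t s)) using 1
    simp
    ring
  have hn := hR.norm_fst_lt hZ hs
  have h1 := hZ.hasDerivAt_preEKW hU hs hx (hasDerivAt_const (lam s) (0 : ℂ))
    ((_root_.norm_fst_le _).trans_lt hn) (by simpa using hZ.r_pos)
  rw [clm_split, ← Prod.zero_eq_mk, ← Prod.zero_eq_mk, map_zero, zero_mul, add_zero, zero_add,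
    mul_comm] at h1
  convert! h1 using 1
  funext x
  simp [pre]

theorem mu_eq (hR : IsScaling U r Z t lam) (hZ : IsMidpointBranch U r Z) (hU : IsOpen U)
    {s : SymSpace} (hs : s ∈ U) : mu Z t lam s = muParam Z (s, (t s, lam s)) := by
  rw [mu, (hR.deriv_pre_zero hZ hU hs).deriv, muParam]

theorem lam_ne_zero (hR : IsScaling U r Z t lam) {s : SymSpace} (hs : s ∈ U) : lam s ≠ 0 :=
  fun h => hR.mu_ne_zero s hs (by simp [mu, h])

theorem pre_eq_preParam (s : SymSpace) (p : ℂ × ℂ) :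
    pre Z t s (lam s * p.1) (lam s * p.2) = preParam Z ((s, (t s, lam s)), p) := rfl

theorem hasDerivAt_pre_fst (hR : IsScaling U r Z t lam) (hZ : IsMidpointBranch U r Z)
    (hU : IsOpen U) {s : SymSpace} (hs : s ∈ U) {x y : ℂ} (hx : ‖x‖ < rho) (hy : ‖y‖ < rho) :
    HasDerivAt (fun x => pre Z t s (lam s * x) (lam s * y))
      (lam s * (1 + 2 * t s * (lam s * x)) * (1 + 2 * t s * (lam s * y)) *
        fderiv ℂ (preUncurried Z) (s, (lam s * x + t s * (lam s * x) ^ 2,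
          lam s * y + t s * (lam s * y) ^ 2)) (0, (1, 0))) x := by
  have hx' : HasDerivAt (fun x : ℂ => lam s * x + t s * (lam s * x) ^ 2)
      (lam s * (1 + 2 * t s * (lam s * x))) x := by
    have h0 : HasDerivAt (fun x : ℂ => lam s * x) (lam s) x := by
      simpa using (hasDerivAt_id x).const_mul (lam s)
    convert! h0.add ((h0.pow 2).const_mul (t s)) using 1
    simp
    ring
  have h1 := hZ.hasDerivAt_preEKW hU hs hx'
    (hasDerivAt_const x (lam s * y + t s * (lam s * y) ^ 2))
    (hR.domain s hs x hx.le) (hR.domain s hs y hy.le)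
  rw [clm_split, ← Prod.zero_eq_mk, ← Prod.zero_eq_mk, map_zero, zero_mul, add_zero, zero_add] at h1
  convert! h1.const_mul (1 + 2 * t s * (lam s * y)) using 1
  ring

/-- The function defining the renormalized `s` belongs to `𝒜_s(ρ)`. -/
theorem ev_renorm (hR : IsScaling U r Z t lam) (hZ : IsMidpointBranch U r Z) (hU : IsOpen U)
    {s : SymSpace} (hs : s ∈ U) {p : ℂ × ℂ} (hp : ‖p‖ < rho) :
    ev (renorm Z t lam s) p.1 p.2 =
      (mu Z t lam s)⁻¹ * pre Z t s (lam s * p.1) (lam s * p.2) := by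
  obtain ⟨Φ, -, hΦ⟩ := hR.exists_family hZ hU hs
  have h1 := hΦ.self_of_nhds
  set g : FunSpace := (mu Z t lam s)⁻¹ • Φ (s, (t s, lam s)) with hg
  have hgev : ∀ p : ℂ × ℂ, ‖p‖ < rho →
      g.eval p.1 p.2 = (mu Z t lam s)⁻¹ * pre Z t s (lam s * p.1) (lam s * p.2) := by
    intro p hp
    rw [pre_eq_preParam, ← h1 p hp, ← FunSpace.evalL_apply hp, ← FunSpace.evalL_apply hp, hg,
      map_smul, smul_eq_mul]
  have hderiv : ∀ x y : ℂ, ‖x‖ < rho → ‖y‖ < rho → deriv (fun x' => g.eval x' y) x =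
      (mu Z t lam s)⁻¹ * (lam s * (1 + 2 * t s * (lam s * x)) * (1 + 2 * t s * (lam s * y)) *
        fderiv ℂ (preUncurried Z) (s, (lam s * x + t s * (lam s * x) ^ 2,
          lam s * y + t s * (lam s * y) ^ 2)) (0, (1, 0))) := by
    intro x y hx hy
    have h2 : (fun x' => g.eval x' y) =ᶠ[𝓝 x]
        fun x' => (mu Z t lam s)⁻¹ * pre Z t s (lam s * x') (lam s * y) := by
      filter_upwards [(isOpen_lt continuous_norm continuous_const).mem_nhds hx] with x' hx'
      exact hgev (x', y) (norm_mk_lt hx' hy)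
    rw [h2.deriv_eq]
    exact ((hR.hasDerivAt_pre_fst hZ hU hs hx hy).const_mul _).deriv
  have hsym : g ∈ symSubmodule := FunSpace.mem_symSubmodule_of_deriv fun x y hx hy => by
    rw [hderiv x y hx hy, hderiv y x hy hx,
      hZ.fderiv_pre_symm hU hs (hR.domain s hs x hx.le) (hR.domain s hs y hy.le)]
    ring
  have hex : ∃ g : SymSpace, ∀ x y : ℂ, (x, y) ∈ bidisk rho → ev g x y =
      (mu Z t lam s)⁻¹ * pre Z t s (lam s * x) (lam s * y) :=
    ⟨⟨g, hsym⟩, fun x y hxy => hgev (x, y) (mem_bidisk_iff.1 hxy)⟩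
  rw [renorm, ofFun, dif_pos hex]
  exact Classical.choose_spec hex p.1 p.2 (mem_bidisk_iff.2 hp)

/-- The condition `μ ≠ 0` makes `λ` a simple zero of `x ↦ 𝒫[s](x,0)`. Keeping `t` as an independent
variable in the implicit equation requires of `t[s]` only differentiability at the point. -/
theorem differentiableAt_lam (hR : IsScaling U r Z t lam) (hZ : IsMidpointBranch U r Z)
    (hU : IsOpen U) {s : SymSpace} (hs : s ∈ U) (ht : DifferentiableAt ℂ t s) :
    DifferentiableAt ℂ lam s := by
  let sub : (SymSpace × ℂ) × ℂ → SymSpace × (ℂ × ℂ) := fun v => (v.1.1, (v.2 + v.1.2 * v.2 ^ 2, 0))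
  have hsub : ContDiff ℂ 1 sub := by fun_prop
  have hM : ContDiffAt ℂ 1 (fun v => preUncurried Z (sub v)) ((s, t s), lam s) :=
    ContDiffAt.comp _ ((hZ.contDiffAt_pre hU (q := sub ((s, t s), lam s)) hs
      (hR.norm_fst_lt hZ hs)).of_le (by simp)) hsub.contDiffAt
  have hval : ∀ s ∈ U, preUncurried Z (sub ((s, t s), lam s)) = 0 := fun s hs => by
    have h1 := hR.zero s hs
    simpa [pre, preUncurried, sub] using h1
  have hd : fderiv ℂ (fun v => preUncurried Z (sub v)) ((s, t s), lam s) (0, 1) ≠ 0 := by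
    have h1 : HasDerivAt (fun z : ℂ => (((s, t s), z) : (SymSpace × ℂ) × ℂ)) (0, 1) (lam s) :=
      (hasDerivAt_const _ (s, t s)).prodMk (hasDerivAt_id _)
    have h2 := HasFDerivAt.comp_hasDerivAt (lam s)
      (hM.differentiableAt one_ne_zero).hasFDerivAt h1
    have h3 := hR.deriv_pre_zero hZ hU hs
    have h4 : (fun x => pre Z t s x 0) =
        (fun v => preUncurried Z (sub v)) ∘ fun z : ℂ => ((s, t s), z) := by
      funext x
      simp [pre, sub, preUncurried]
    intro h5
    refine hR.mu_ne_zero s hs ?_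
    rw [mu, h4, h2.deriv, h5, mul_zero]
  obtain ⟨f, hf, h⟩ := exists_implicit one_ne_zero hM hd
  have hlam : ContinuousAt lam s := hR.cont.continuousAt (hU.mem_nhds hs)
  have hc : ContinuousAt (fun s => ((s, t s), lam s)) s :=
    (continuousAt_id.prodMk ht.continuousAt).prodMk hlam
  have h1 : DifferentiableAt ℂ (fun s => f (s, t s)) s :=
    DifferentiableAt.comp (f := fun s => (s, t s)) s (hf.differentiableAt one_ne_zero)
      (differentiableAt_id.prodMk ht)
  refine h1.congr_of_eventuallyEq ?_
  filter_upwards [hc.eventually h, hU.mem_nhds hs] with s' h2 h3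
  exact (h2.1 ((hval s' h3).trans (hval s hs).symm)).symm

theorem differentiableAt_params (hR : IsScaling U r Z t lam) (hZ : IsMidpointBranch U r Z)
    (hU : IsOpen U) {s : SymSpace} (hs : s ∈ U) (ht : DifferentiableAt ℂ t s) :
    DifferentiableAt ℂ (fun s => (s, (t s, lam s))) s :=
  differentiableAt_id.prodMk (ht.prodMk (hR.differentiableAt_lam hZ hU hs ht))

theorem differentiableAt_mu (hR : IsScaling U r Z t lam) (hZ : IsMidpointBranch U r Z)
    (hU : IsOpen U) {s : SymSpace} (hs : s ∈ U) (ht : DifferentiableAt ℂ t s) :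
    DifferentiableAt ℂ (mu Z t lam) s := by
  have h1 : DifferentiableAt ℂ (muParam Z) (s, (t s, lam s)) := by
    let sub : SymSpace × (ℂ × ℂ) → SymSpace × (ℂ × ℂ) := fun e =>
      (e.1, (e.2.2 + e.2.1 * e.2.2 ^ 2, 0))
    have hsub : ContDiff ℂ 1 sub := by fun_prop
    have hfd : ContDiffAt ℂ 1 (fderiv ℂ (preUncurried Z)) (sub (s, (t s, lam s))) :=
      (hZ.contDiffAt_pre hU (q := sub (s, (t s, lam s))) hs (hR.norm_fst_lt hZ hs)).fderiv_right
        (by simp)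
    have hc : DifferentiableAt ℂ (fun e => fderiv ℂ (preUncurried Z) (sub e)) (s, (t s, lam s)) :=
      (ContDiffAt.comp (s, (t s, lam s)) hfd hsub.contDiffAt).differentiableAt one_ne_zero
    have hc' : DifferentiableAt ℂ (fun e => fderiv ℂ (preUncurried Z) (sub e) (0, (1, 0)))
      (s, (t s, lam s)) := hc.clm_apply (differentiableAt_const _)
    exact DifferentiableAt.mul (by fun_prop) (hc'.mul (by fun_prop))
  have h2 := DifferentiableAt.comp (f := fun s => (s, (t s, lam s))) s h1
    (hR.differentiableAt_params hZ hU hs ht)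
  refine h2.congr_of_eventuallyEq ?_
  filter_upwards [hU.mem_nhds hs] with s' hs'
  exact hR.mu_eq hZ hU hs'

theorem differentiableAt_renorm (hR : IsScaling U r Z t lam) (hZ : IsMidpointBranch U r Z)
    (hU : IsOpen U) {s : SymSpace} (hs : s ∈ U) (ht : DifferentiableAt ℂ t s) :
    DifferentiableAt ℂ (renorm Z t lam) s := by
  have hclosed : IsClosed (symSubmodule : Set FunSpace) :=
    (completeSpace_coe_iff_isComplete.1 (inferInstanceAs (CompleteSpace SymSpace))).isClosed
  refine Submodule.differentiableAt_of_coe hclosed ?_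
  obtain ⟨Φ, hΦd, hΦ⟩ := hR.exists_family hZ hU hs
  have hpar := hR.differentiableAt_params hZ hU hs ht
  have h1 : DifferentiableAt ℂ (fun s => (mu Z t lam s)⁻¹ • Φ (s, (t s, lam s))) s :=
    ((hR.differentiableAt_mu hZ hU hs ht).inv (hR.mu_ne_zero s hs)).smul
      (DifferentiableAt.comp (f := fun s => (s, (t s, lam s))) s hΦd hpar)
  refine h1.congr_of_eventuallyEq ?_
  filter_upwards [hpar.continuousAt.eventually hΦ, hU.mem_nhds hs] with s' h2 hs'
  refine FunSpace.eq_of_eval_eq fun p hp => ?_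
  have hp' := mem_bidisk_iff.1 hp
  have h3 := hR.ev_renorm hZ hU hs' hp'
  rw [ev] at h3
  rw [h3, pre_eq_preParam, ← h2 p hp', ← FunSpace.evalL_apply hp', ← FunSpace.evalL_apply hp',
    map_smul, smul_eq_mul]

end IsScaling

/-! ### The derivative of the renormalization operators at a fixed point -/

theorem FunSpace.iteratedDeriv_eq_coeff {g : FunSpace} {f : ℂ → ℂ} (hf : AnalyticAt ℂ f 0) {c : ℂ}
    (hc : c ≠ 0) (h : ∀ y : ℂ, ‖y‖ < rho → g.eval 0 y = f (c * y)) (j : ℕ) :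
    iteratedDeriv j f 0 / (j ! : ℂ) = g.coeff 0 j / c ^ j := by
  let P : FormalMultilinearSeries ℂ ℂ ℂ :=
    fun n => ContinuousMultilinearMap.mkPiRing ℂ (Fin n) (g.coeff 0 n / c ^ n)
  have h1 : HasFPowerSeriesAt f P 0 := by
    refine hasFPowerSeriesAt_iff.2 ?_
    have hcont : ContinuousAt (fun z : ℂ => ‖z / c‖) 0 := by fun_prop
    filter_upwards [hcont.eventually_lt continuousAt_const
      (show ‖(0 : ℂ) / c‖ < rho by simpa using rho_pos)] with z hz
    have h2 := (summable_powerSeries₂ g.summable_coeff (x := 0) (y := z / c)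
      (by simpa using rho_pos.le) hz.le).hasSum
    have h3 := h (z / c) hz
    rw [FunSpace.eval] at h3
    rw [h3, mul_div_cancel₀ _ hc] at h2
    have h4 : ∀ p ∉ Set.range (Prod.mk (0 : ℕ) : ℕ → ℕ × ℕ),
        g.coeff p.1 p.2 * 0 ^ p.1 * (z / c) ^ p.2 = 0 := by
      rintro ⟨i, k⟩ hp
      rcases i with _ | i
      · exact absurd ⟨k, rfl⟩ hp
      · simp
    rw [zero_add]
    refine (((Prod.mk_right_injective (0 : ℕ)).hasSum_iff h4).2 h2).congr_fun fun n => ?_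
    simp [P, FormalMultilinearSeries.coeff, div_pow]
    ring
  have h2 := congrArg (fun p => FormalMultilinearSeries.coeff p j)
    (hf.hasFPowerSeriesAt.eq_formalMultilinearSeries h1)
  simp only [FormalMultilinearSeries.coeff_ofScalars] at h2
  rw [h2]
  simp [P, FormalMultilinearSeries.coeff]

/-- With `t = 0` and `λ` frozen, the rescaled prerenormalization is a differentiable `ℓ¹`-valued
family, and the coefficient is a bounded functional of it. -/
theorem differentiableAt_preCoeff {U : Set SymSpace} {r : ℝ} {Z : SymSpace → ℂ × ℂ → ℂ}
    {lam : SymSpace → ℂ} (hE : IsScaling U r Z (fun _ => 0) lam) (hZ : IsMidpointBranch U r Z)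
    (hU : IsOpen U) {s : SymSpace} (hs : s ∈ U) (j : ℕ) :
    DifferentiableAt ℂ (fun s => preCoeff Z s j) s := by
  obtain ⟨Φ, hΦd, hΦ⟩ := hE.exists_family hZ hU hs
  have hpar : DifferentiableAt ℂ (fun s' : SymSpace => (s', ((0 : ℂ), lam s))) s := by fun_prop
  have h1 : DifferentiableAt ℂ (fun s' => Φ (s', ((0 : ℂ), lam s))) s :=
    DifferentiableAt.comp (f := fun s' : SymSpace => (s', ((0 : ℂ), lam s))) s hΦd hpar
  let T : FunSpace →L[ℂ] ℂ :=
    (((rho : ℂ) ^ (0 + j))⁻¹ * (lam s ^ j)⁻¹) • lp.evalCLM ℂ (fun _ : ℕ × ℕ => ℂ) 1 (0, j)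
  have hT (g : FunSpace) : g.coeff 0 j / lam s ^ j = T g := by
    rw [FunSpace.coeff, div_eq_mul_inv, div_eq_mul_inv, mul_assoc, mul_comm]
    rfl
  have h2 : DifferentiableAt ℂ (fun s' => T (Φ (s', ((0 : ℂ), lam s)))) s :=
    T.differentiableAt.comp s h1
  refine h2.congr_of_eventuallyEq ?_
  have hev : ∀ᶠ s' in 𝓝 s, ∀ p : ℂ × ℂ, ‖p‖ < rho →
      (Φ (s', ((0 : ℂ), lam s))).eval p.1 p.2 = preParam Z ((s', ((0 : ℂ), lam s)), p) :=
    hpar.continuousAt.eventually hΦ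
  filter_upwards [hev, hU.mem_nhds hs] with s' h3 hs'
  rw [← hT]
  refine FunSpace.iteratedDeriv_eq_coeff ?_ (hE.lam_ne_zero hs) (fun y hy => ?_) j
  · have h4 := hZ.contDiffAt_pre hU (q := (s', (0, 0))) hs' (by simpa using hZ.r_pos)
    exact (ContDiffAt.comp (f := fun y : ℂ => (s', ((0 : ℂ), y))) (0 : ℂ) h4
      (by fun_prop)).analyticAt
  · rw [h3 (0, y) (norm_mk_lt (by simpa using rho_pos) hy)]
    simp [preParam, preUncurried]

/-- The functional `s ↦ ∂₁ s (x, y)`. -/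
noncomputable def evD₁L (x y : ℂ) : SymSpace →L[ℂ] ℂ := deriv (fun x' => evL (x', y)) x

theorem evD₁L_apply {x y : ℂ} (hx : ‖x‖ < rho) (hy : ‖y‖ < rho) (s : SymSpace) :
    evD₁L x y s = evD₁ s x y := by
  have h1 : DifferentiableAt ℂ (fun x' => evL (x', y)) x := by
    have h2 := (FunSpace.contDiffAt_evalL (n := 1) (norm_mk_lt hx hy)).differentiableAt one_ne_zero
    have h3 : DifferentiableAt ℂ (fun x' => FunSpace.evalL (x', y)) x :=
      DifferentiableAt.comp (f := fun x' : ℂ => (x', y)) x h2 (by fun_prop)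
    exact h3.clm_comp (differentiableAt_const _)
  have hd : HasDerivAt (fun x' => evL (x', y)) (evD₁L x y) x :=
    DifferentiableAt.hasDerivAt (𝕜 := ℂ) (F := SymSpace →L[ℂ] ℂ) h1
  have h2 : HasDerivAt (fun x' => evL (x', y) s) (evD₁L x y s) x :=
    HasFDerivAt.comp_hasDerivAt (f := fun x' => evL (x', y)) x
      (ContinuousLinearMap.apply ℂ ℂ s).hasFDerivAt hd
  rw [evD₁, ← h2.deriv]
  refine Filter.EventuallyEq.deriv_eq ?_
  filter_upwards [(isOpen_lt continuous_norm continuous_const).mem_nhds hx] with x' hx'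
  exact evL_apply (norm_mk_lt hx' hy) s

theorem one_lt_rho : ‖(1 : ℂ)‖ < rho := by norm_num [rho]

theorem zero_lt_rho : ‖(0 : ℂ)‖ < rho := by norm_num [rho]

/-- A tangent vector that is a combination of infinitesimal multiplication, scaling and quadratic
coordinate change, and respects the normalization, is a multiple of `ψ`. -/
theorem eq_smul_of_normalized {s u w : SymSpace} (h0 : ev s 1 0 = 0) (h1 : evD₁ s 1 0 = 1)
    (hw : ∀ x y : ℂ, ‖x‖ < rho → ‖y‖ < rho → ev w x y = evD₁ s x y * x ^ 2 +
      evD₂ s x y * y ^ 2 + 2 * ev s x y * y - ev s x y - (evD₁ s x y * x + evD₂ s x y * y))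
    {a b c : ℂ} (hu : ∀ x y : ℂ, ‖x‖ < rho → ‖y‖ < rho → ev u x y = a * ev s x y +
      b * (x * evD₁ s x y + y * evD₂ s x y) +
        c * (2 * y * ev s x y + x ^ 2 * evD₁ s x y + y ^ 2 * evD₂ s x y))
    (hu0 : ev u 1 0 = 0) (hu1 : evD₁ u 1 0 = 0) : u = c • w := by
  -- The value at `(1,0)`, where `s = 0` and `∂₁s = 1`, gives `b + c = 0`.
  have hb : b = -c := by
    have h2 := hu 1 0 one_lt_rho zero_lt_rho
    rw [hu0, h0, h1] at h2
    linear_combination -h2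
  -- The `x`-derivative at `(1,0)` is `a + b + 2c + (b + c) ∂₁∂₁s`. The second derivative drops out
  -- because `b + c = 0`.
  have ha : a = -c := by
    have hs : HasDerivAt (fun x => ev s x 0) 1 1 := by
      have h2 := (differentiableAt_ev_fst s one_lt_rho zero_lt_rho).hasDerivAt
      rwa [← evD₁, h1] at h2
    have hs1 : DifferentiableAt ℂ (fun x => evD₁ s x 0) 1 := by
      have h2 : DifferentiableOn ℂ (fun x => ev s x 0) (ball 0 rho) := fun x hx =>
        (differentiableAt_ev_fst s (by simpa using hx) zero_lt_rho).differentiableWithinAt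
      exact (h2.deriv isOpen_ball).differentiableAt
        (isOpen_ball.mem_nhds (by simpa using one_lt_rho))
    have hid := hasDerivAt_id (1 : ℂ)
    have h2 : HasDerivAt (fun x => a * ev s x 0 + b * (x * evD₁ s x 0) + c * (x ^ 2 * evD₁ s x 0))
        _ 1 := ((hs.const_mul a).add ((hid.mul hs1.hasDerivAt).const_mul b)).add
          (((hasDerivAt_pow 2 (1 : ℂ)).mul hs1.hasDerivAt).const_mul c)
    have h3 : (fun x => ev u x 0) =ᶠ[𝓝 1]
        fun x => a * ev s x 0 + b * (x * evD₁ s x 0) + c * (x ^ 2 * evD₁ s x 0) := by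
      filter_upwards [(isOpen_lt continuous_norm continuous_const).mem_nhds one_lt_rho] with x hx
      rw [hu x 0 hx zero_lt_rho]
      ring
    have h4 := h3.deriv_eq
    rw [h2.deriv, ← evD₁, hu1] at h4
    simp [h1] at h4
    rw [hb] at h4
    linear_combination -h4
  refine SymSpace.ext_ev fun p hp => ?_
  have hx := (norm_fst_le p).trans_lt hp
  have hy := (norm_snd_le p).trans_lt hp
  rw [← evL_apply hp (c • w), map_smul, evL_apply hp, smul_eq_mul, hu _ _ hx hy, hw _ _ hx hy, ha,
    hb]
  ring

namespace IsScaling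

variable {U : Set SymSpace} {r : ℝ} {Z : SymSpace → ℂ × ℂ → ℂ} {t lam : SymSpace → ℂ}

theorem ev_renorm_one_zero (hR : IsScaling U r Z t lam) (hZ : IsMidpointBranch U r Z)
    (hU : IsOpen U) {s : SymSpace} (hs : s ∈ U) : ev (renorm Z t lam s) 1 0 = 0 := by
  rw [hR.ev_renorm hZ hU hs (p := (1, 0)) (norm_mk_lt one_lt_rho zero_lt_rho)]
  simp [hR.zero s hs]

theorem evD₁_renorm_one_zero (hR : IsScaling U r Z t lam) (hZ : IsMidpointBranch U r Z)
    (hU : IsOpen U) {s : SymSpace} (hs : s ∈ U) : evD₁ (renorm Z t lam s) 1 0 = 1 := by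
  have h1 : (fun x => ev (renorm Z t lam s) x 0) =ᶠ[𝓝 1]
      fun x => (mu Z t lam s)⁻¹ * pre Z t s (lam s * x) (lam s * 0) := by
    filter_upwards [(isOpen_lt continuous_norm continuous_const).mem_nhds one_lt_rho] with x hx
    exact hR.ev_renorm hZ hU hs (p := (x, 0)) (norm_mk_lt hx zero_lt_rho)
  have h2 := (hR.hasDerivAt_pre_fst hZ hU hs one_lt_rho zero_lt_rho).const_mul (mu Z t lam s)⁻¹
  rw [evD₁, h1.deriv_eq, h2.deriv]
  have h3 := hR.mu_ne_zero s hs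
  rw [inv_mul_eq_one₀ h3, hR.mu_eq hZ hU hs, muParam]
  simp
  ring

/-- The normalization holds identically on `U`, so its differential vanishes on the image of the
derivative. -/
theorem ev_fderiv_one_zero (hR : IsScaling U r Z t lam) (hZ : IsMidpointBranch U r Z)
    (hU : IsOpen U) {s : SymSpace} (hs : s ∈ U) (ht : DifferentiableAt ℂ t s) (v : SymSpace) :
    ev (fderiv ℂ (renorm Z t lam) s v) 1 0 = 0 := by
  have hp := norm_mk_lt one_lt_rho zero_lt_rho
  have h1 := (evL (1, 0)).hasFDerivAt.comp s (hR.differentiableAt_renorm hZ hU hs ht).hasFDerivAt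
  have h2 : HasFDerivAt (fun _ : SymSpace => (0 : ℂ)) _ s := h1.congr_of_eventuallyEq (by
    filter_upwards [hU.mem_nhds hs] with s' hs'
    exact ((evL_apply hp _).trans (hR.ev_renorm_one_zero hZ hU hs')).symm)
  have h3 := DFunLike.congr_fun (h2.unique (hasFDerivAt_const (0 : ℂ) s)) v
  exact (evL_apply hp _).symm.trans h3

theorem evD₁_fderiv_one_zero (hR : IsScaling U r Z t lam) (hZ : IsMidpointBranch U r Z)
    (hU : IsOpen U) {s : SymSpace} (hs : s ∈ U) (ht : DifferentiableAt ℂ t s) (v : SymSpace) :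
    evD₁ (fderiv ℂ (renorm Z t lam) s v) 1 0 = 0 := by
  have h1 := (evD₁L 1 0).hasFDerivAt.comp s (hR.differentiableAt_renorm hZ hU hs ht).hasFDerivAt
  have h2 : HasFDerivAt (fun _ : SymSpace => (1 : ℂ)) _ s := h1.congr_of_eventuallyEq (by
    filter_upwards [hU.mem_nhds hs] with s' hs'
    exact ((evD₁L_apply one_lt_rho zero_lt_rho _).trans (hR.evD₁_renorm_one_zero hZ hU hs')).symm)
  have h3 := DFunLike.congr_fun (h2.unique (hasFDerivAt_const (1 : ℂ) s)) v
  exact (evD₁L_apply one_lt_rho zero_lt_rho _).symm.trans h3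

theorem norm_lam_mul_lt (hR : IsScaling U r Z t lam) {s : SymSpace} (hs : s ∈ U) (ht0 : t s = 0)
    {x : ℂ} (hx : ‖x‖ < rho) : ‖lam s * x‖ < r := by
  simpa [ht0] using hR.domain s hs x hx.le

theorem ev_eq_of_fixed (hR : IsScaling U r Z t lam) (hZ : IsMidpointBranch U r Z)
    (hU : IsOpen U) {s : SymSpace} (hs : s ∈ U) (ht0 : t s = 0) (hfix : renorm Z t lam s = s)
    {x y : ℂ} (hx : ‖x‖ < rho) (hy : ‖y‖ < rho) :
    ev s x y = (mu Z t lam s)⁻¹ * preEKW Z s (lam s * x) (lam s * y) := by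
  have h1 := hR.ev_renorm hZ hU hs (norm_mk_lt hx hy)
  rw [hfix] at h1
  simpa [pre, ht0] using h1

theorem evD₁_eq_of_fixed (hR : IsScaling U r Z t lam) (hZ : IsMidpointBranch U r Z)
    (hU : IsOpen U) {s : SymSpace} (hs : s ∈ U) (ht0 : t s = 0) (hfix : renorm Z t lam s = s)
    {x y : ℂ} (hx : ‖x‖ < rho) (hy : ‖y‖ < rho) :
    evD₁ s x y = (mu Z t lam s)⁻¹ *
      (lam s * fderiv ℂ (preUncurried Z) (s, (lam s * x, lam s * y)) (0, (1, 0))) := by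
  have hlin : HasDerivAt (fun x : ℂ => lam s * x) (lam s) x := by
    simpa using (hasDerivAt_id x).const_mul (lam s)
  have h1 := hZ.hasDerivAt_preEKW hU hs hlin (hasDerivAt_const x (lam s * y))
    (hR.norm_lam_mul_lt hs ht0 hx) (hR.norm_lam_mul_lt hs ht0 hy)
  rw [clm_split, ← Prod.zero_eq_mk, ← Prod.zero_eq_mk, map_zero, zero_mul, add_zero, zero_add]
    at h1
  rw [evD₁, ← (h1.const_mul _).deriv]
  refine Filter.EventuallyEq.deriv_eq ?_
  filter_upwards [(isOpen_lt continuous_norm continuous_const).mem_nhds hx] with x' hx'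
  exact hR.ev_eq_of_fixed hZ hU hs ht0 hfix hx' hy

theorem evD₂_eq_of_fixed (hR : IsScaling U r Z t lam) (hZ : IsMidpointBranch U r Z)
    (hU : IsOpen U) {s : SymSpace} (hs : s ∈ U) (ht0 : t s = 0) (hfix : renorm Z t lam s = s)
    {x y : ℂ} (hx : ‖x‖ < rho) (hy : ‖y‖ < rho) :
    evD₂ s x y = (mu Z t lam s)⁻¹ *
      (lam s * fderiv ℂ (preUncurried Z) (s, (lam s * x, lam s * y)) (0, (0, 1))) := by
  have hlin : HasDerivAt (fun y : ℂ => lam s * y) (lam s) y := by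
    simpa using (hasDerivAt_id y).const_mul (lam s)
  have h1 := hZ.hasDerivAt_preEKW hU hs (hasDerivAt_const y (lam s * x)) hlin
    (hR.norm_lam_mul_lt hs ht0 hx) (hR.norm_lam_mul_lt hs ht0 hy)
  rw [clm_split, ← Prod.zero_eq_mk, ← Prod.zero_eq_mk, map_zero, zero_mul, add_zero, zero_add]
    at h1
  rw [evD₂, ← (h1.const_mul _).deriv]
  refine Filter.EventuallyEq.deriv_eq ?_
  filter_upwards [(isOpen_lt continuous_norm continuous_const).mem_nhds hy] with y' hy'
  exact hR.ev_eq_of_fixed hZ hU hs ht0 hfix hx hy'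

/-- At a fixed point, the derivative of the renormalization operator is that of the
prerenormalization, up to a combination of infinitesimal multiplication, scaling and
quadratic coordinate change. -/
theorem exists_ev_fderiv_renorm (hR : IsScaling U r Z t lam) (hZ : IsMidpointBranch U r Z)
    (hU : IsOpen U) {s : SymSpace} (hs : s ∈ U) (ht : DifferentiableAt ℂ t s) (ht0 : t s = 0)
    (hfix : renorm Z t lam s = s) (v : SymSpace) :
    ∃ a b : ℂ, ∀ x y : ℂ, ‖x‖ < rho → ‖y‖ < rho →
      ev (fderiv ℂ (renorm Z t lam) s v) x y =
        (mu Z t lam s)⁻¹ * fderiv ℂ (preUncurried Z) (s, (lam s * x, lam s * y)) (v, (0, 0)) +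
        a * ev s x y + b * (x * evD₁ s x y + y * evD₂ s x y) +
        lam s * fderiv ℂ t s v *
          (2 * y * ev s x y + x ^ 2 * evD₁ s x y + y ^ 2 * evD₂ s x y) := by
  have hl := (hR.differentiableAt_lam hZ hU hs ht).hasFDerivAt.hasLineDerivAt v
  have hm := (hR.differentiableAt_mu hZ hU hs ht).hasFDerivAt.hasLineDerivAt v
  have ht' := ht.hasFDerivAt.hasLineDerivAt v
  have hr := (hR.differentiableAt_renorm hZ hU hs ht).hasFDerivAt.hasLineDerivAt v
  have hlam := hR.lam_ne_zero hs
  have hmu := hR.mu_ne_zero s hs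
  set lam' := fderiv ℂ lam s v
  set mu' := fderiv ℂ (mu Z t lam) s v
  set t' := fderiv ℂ t s v
  -- These are the logarithmic derivatives of `μ⁻¹` and `λ` along `v`.
  refine ⟨-(mu' / mu Z t lam s), lam' / lam s, fun x y hx hy => ?_⟩
  have hp := norm_mk_lt hx hy
  have hxr : ‖lam s * x‖ < r := by simpa [ht0] using hR.domain s hs x hx.le
  have hyr : ‖lam s * y‖ < r := by simpa [ht0] using hR.domain s hs y hy.le
  rw [HasLineDerivAt] at hl hm ht' hr
  have hev : HasDerivAt (fun z : ℂ => ev (renorm Z t lam (s + z • v)) x y)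
      (ev (fderiv ℂ (renorm Z t lam) s v) x y) 0 := by
    have h1 := (evL (x, y)).hasFDerivAt.comp_hasDerivAt (0 : ℂ) hr
    rw [evL_apply hp] at h1
    exact h1.congr_of_eventuallyEq (Eventually.of_forall fun z => (evL_apply hp _).symm)
  have hcoord (x : ℂ) : HasDerivAt (fun z : ℂ => lam (s + z • v) * x +
      t (s + z • v) * (lam (s + z • v) * x) ^ 2) (lam' * x + t' * (lam s * x) ^ 2) 0 := by
    have h1 := hl.mul_const x
    convert! h1.add (ht'.mul (h1.pow 2)) using 1
    simp [ht0]
  have hcurve : HasDerivAt (fun z : ℂ => s + z • v) v 0 := by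
    simpa using ((hasDerivAt_id (0 : ℂ)).smul_const v).const_add s
  have hP : HasDerivAt (fun z : ℂ => preUncurried Z (s + z • v,
      (lam (s + z • v) * x + t (s + z • v) * (lam (s + z • v) * x) ^ 2,
        lam (s + z • v) * y + t (s + z • v) * (lam (s + z • v) * y) ^ 2)))
      (fderiv ℂ (preUncurried Z) (s, (lam s * x, lam s * y))
        (v, (lam' * x + t' * (lam s * x) ^ 2, lam' * y + t' * (lam s * y) ^ 2))) 0 := by
    have h1 := ((hZ.contDiffAt_pre hU (q := (s, (lam s * x, lam s * y))) hs
      (norm_mk_lt hxr hyr)).differentiableAt (by simp)).hasFDerivAt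
    exact HasFDerivAt.comp_hasDerivAt_of_eq (0 : ℂ) h1
      (hcurve.prodMk ((hcoord x).prodMk (hcoord y))) (by simp [ht0])
  have hfac : HasDerivAt (fun z : ℂ => 1 + 2 * t (s + z • v) * (lam (s + z • v) * y))
      (2 * t' * (lam s * y)) 0 := by
    convert! ((ht'.const_mul 2).mul (hl.mul_const y)).const_add 1 using 1
    simp [ht0]
  have hrhs := (hm.inv (by simpa using hmu)).mul (hfac.mul hP)
  have hevE := hrhs.congr_of_eventuallyEq
    (f₁ := fun z : ℂ => ev (renorm Z t lam (s + z • v)) x y) <| by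
    have hc : ContinuousAt (fun z : ℂ => s + z • v) 0 := by fun_prop
    filter_upwards [hc.eventually (p := fun s' => s' ∈ U) (by simpa using hU.mem_nhds hs)] with z hz
    exact hR.ev_renorm hZ hU hz hp
  have key := hev.unique hevE
  have hval := hR.ev_eq_of_fixed hZ hU hs ht0 hfix hx hy
  have hd₁ := hR.evD₁_eq_of_fixed hZ hU hs ht0 hfix hx hy
  have hd₂ := hR.evD₂_eq_of_fixed hZ hU hs ht0 hfix hx hy
  rw [clm_split] at key
  simp only [Pi.inv_apply, Pi.mul_apply, zero_smul, add_zero, ht0, mul_zero, zero_mul, one_mul,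
    preUncurried] at key
  -- The fixed-point equation and its two partial derivatives express `s`, `∂₁s` and `∂₂s` through
  -- the prerenormalization at `(λx, λy)`, so both sides are compared there.
  rw [key, hd₁, hd₂, hval]
  field_simp
  ring

end IsScaling

/-! ### The eigenvector `ψ` and the rank-one effect of the coordinate change. -/

namespace IsScaling

variable {U : Set SymSpace} {r : ℝ} {Z : SymSpace → ℂ × ℂ → ℂ} {t lam lamE : SymSpace → ℂ}

/-- The function `ψ` is an eigenvector of `Dℛ_EKW` for the eigenvalue `λ` at a fixed point. -/
theorem fderiv_renormEKW_psi (hE : IsScaling U r Z (fun _ => 0) lamE)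
    (hZ : IsMidpointBranch U r Z) (hU : IsOpen U) {s : SymSpace} (hs : s ∈ U)
    (hfix : renormEKW Z lamE s = s) {w : SymSpace}
    (hw : ∀ x y : ℂ, ‖x‖ < rho → ‖y‖ < rho → ev w x y = evD₁ s x y * x ^ 2 +
      evD₂ s x y * y ^ 2 + 2 * ev s x y * y - ev s x y - (evD₁ s x y * x + evD₂ s x y * y)) :
    fderiv ℂ (renormEKW Z lamE) s w = lamE s • w := by
  have ht : DifferentiableAt ℂ (fun _ : SymSpace => (0 : ℂ)) s := differentiableAt_const _
  have h0 := hE.ev_renorm_one_zero hZ hU hs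
  have h1 := hE.evD₁_renorm_one_zero hZ hU hs
  rw [← renormEKW, hfix] at h0 h1
  obtain ⟨a, b, hab⟩ := hE.exists_ev_fderiv_renorm hZ hU hs ht rfl hfix w
  -- After rescaling, the generator of `ψ` at `(λx, λy)` has quadratic part multiplied by `λ`, while
  -- its multiplication and scaling parts keep the coefficient `-1`.
  refine eq_smul_of_normalized (a := a - 1) (b := b - 1) h0 h1 hw (fun x y hx hy => ?_)
    (hE.ev_fderiv_one_zero hZ hU hs ht w) (hE.evD₁_fderiv_one_zero hZ hU hs ht w)
  have h2 := hab x y hx hy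
  rw [hZ.fderiv_pre_psi hU hs hw (hE.norm_lam_mul_lt hs rfl hx) (hE.norm_lam_mul_lt hs rfl hy),
    clm_split, ← Prod.zero_eq_mk, ← Prod.zero_eq_mk, map_zero] at h2
  have hval := hE.ev_eq_of_fixed hZ hU hs rfl hfix hx hy
  have hd₁ := hE.evD₁_eq_of_fixed hZ hU hs rfl hfix hx hy
  have hd₂ := hE.evD₂_eq_of_fixed hZ hU hs rfl hfix hx hy
  rw [renormEKW, h2, preUncurried]
  simp only [fderiv_fun_const, Pi.zero_apply, zero_apply]
  linear_combination (1 - 2 * lamE s * y) * hval + (x - lamE s * x ^ 2) * hd₁ +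
    (y - lamE s * y ^ 2) * hd₂

/-- A coordinate change whose parameter vanishes at the fixed point changes the derivative of the
renormalization operator by a multiple of `ψ`. -/
theorem fderiv_renorm_eq (hE : IsScaling U r Z (fun _ => 0) lamE) (hR : IsScaling U r Z t lam)
    (hZ : IsMidpointBranch U r Z) (hU : IsOpen U) {s : SymSpace} (hs : s ∈ U)
    (ht : DifferentiableAt ℂ t s) (ht0 : t s = 0) (hlam : lam s = lamE s)
    (hfix : renormEKW Z lamE s = s) (hfixR : renorm Z t lam s = s) {w : SymSpace}
    (hw : ∀ x y : ℂ, ‖x‖ < rho → ‖y‖ < rho → ev w x y = evD₁ s x y * x ^ 2 +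
      evD₂ s x y * y ^ 2 + 2 * ev s x y * y - ev s x y - (evD₁ s x y * x + evD₂ s x y * y))
    (v : SymSpace) :
    fderiv ℂ (renorm Z t lam) s v =
      fderiv ℂ (renormEKW Z lamE) s v + (lamE s * fderiv ℂ t s v) • w := by
  have htE : DifferentiableAt ℂ (fun _ : SymSpace => (0 : ℂ)) s := differentiableAt_const _
  have h0 := hE.ev_renorm_one_zero hZ hU hs
  have h1 := hE.evD₁_renorm_one_zero hZ hU hs
  rw [← renormEKW, hfix] at h0 h1
  obtain ⟨a, b, hab⟩ := hE.exists_ev_fderiv_renorm hZ hU hs htE rfl hfix v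
  obtain ⟨a', b', hab'⟩ := hR.exists_ev_fderiv_renorm hZ hU hs ht ht0 hfixR v
  have hmu : mu Z t lam s = mu Z (fun _ => 0) lamE s := by
    rw [hR.mu_eq hZ hU hs, hE.mu_eq hZ hU hs, ht0, hlam]
  rw [← sub_eq_iff_eq_add']
  have hsub {x y : ℂ} (hx : ‖x‖ < rho) (hy : ‖y‖ < rho) (u u' : SymSpace) :
      ev (u - u') x y = ev u x y - ev u' x y := by
    have hp := norm_mk_lt hx hy
    have h2 := (evL (x, y)).map_sub u u'
    rwa [evL_apply hp, evL_apply hp, evL_apply hp] at h2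
  have hsub₁ (u u' : SymSpace) : evD₁ (u - u') 1 0 = evD₁ u 1 0 - evD₁ u' 1 0 := by
    have h2 := (evD₁L 1 0).map_sub u u'
    rwa [evD₁L_apply one_lt_rho zero_lt_rho, evD₁L_apply one_lt_rho zero_lt_rho,
      evD₁L_apply one_lt_rho zero_lt_rho] at h2
  -- The two operators have the same `λ` and `μ` at `s`, so the derivatives of the
  -- prerenormalization cancel in the difference.
  refine eq_smul_of_normalized (a := a' - a) (b := b' - b) h0 h1 hw (fun x y hx hy => ?_) ?_ ?_
  · have h2 := hab x y hx hy
    have h3 := hab' x y hx hy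
    rw [hmu, hlam] at h3
    rw [hsub hx hy, renormEKW, h2, h3]
    simp only [fderiv_fun_const, Pi.zero_apply, zero_apply]
    ring
  · rw [hsub one_lt_rho zero_lt_rho, hR.ev_fderiv_one_zero hZ hU hs ht, renormEKW,
      hE.ev_fderiv_one_zero hZ hU hs htE, sub_zero]
  · rw [hsub₁, hR.evD₁_fderiv_one_zero hZ hU hs ht, renormEKW,
      hE.evD₁_fderiv_one_zero hZ hU hs htE, sub_zero]

end IsScaling

/-- Derivatives of `s` need not have finite norm at radius `ρ`, and `ofFun` then returns `0`.
Nonvanishing of `ψ`, a consequence of `ℓ(ψ) = 1`, rules this out. -/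
theorem ev_psiEKW {s : SymSpace} (h : psiEKW s ≠ 0) {x y : ℂ} (hx : ‖x‖ < rho) (hy : ‖y‖ < rho) :
    ev (psiEKW s) x y = evD₁ s x y * x ^ 2 + evD₂ s x y * y ^ 2 + 2 * ev s x y * y - ev s x y -
      (evD₁ s x y * x + evD₂ s x y * y) := by
  rw [psiEKW, ofFun] at h ⊢
  by_cases hex : ∃ g : SymSpace, ∀ x y : ℂ, (x, y) ∈ bidisk rho → ev g x y =
      deriv (fun x' => ev s x' y) x * x ^ 2 + deriv (fun y' => ev s x y') y * y ^ 2
      + 2 * ev s x y * y - ev s x y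
      - (deriv (fun x' => ev s x' y) x * x + deriv (fun y' => ev s x y') y * y)
  · rw [dif_pos hex]
    exact Classical.choose_spec hex x y (mem_bidisk_iff.2 (norm_mk_lt hx hy))
  · exact absurd (dif_neg hex) h

/-! ### Spectral theory -/

/-- The Riesz projection fixes the eigenvectors. -/
theorem rieszProj_apply_eigenvector {L : SymSpace →L[ℂ] SymSpace} {κ : ℂ} {ε : ℝ}
    (hε : Isolates L κ ε) {w : SymSpace} (hw : L w = κ • w) : rieszProj L κ ε w = w := by
  have hunit : ∀ z ∈ sphere κ ε, IsUnit (algebraMap ℂ (SymSpace →L[ℂ] SymSpace) z - L) := by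
    intro z hz
    by_contra h
    have hz' : ‖z - κ‖ = ε := by simpa [dist_eq_norm] using hz
    have h1 := hε.2 z h hz'.le
    rw [h1, sub_self, norm_zero] at hz'
    exact hε.1.ne hz'
  have hcont : ContinuousOn (fun z : ℂ => resolvent L z) (sphere κ ε) := by
    intro z hz
    obtain ⟨u, hu⟩ := hunit z hz
    have h1 : ContinuousAt Ring.inverse (algebraMap ℂ (SymSpace →L[ℂ] SymSpace) z - L) := by
      rw [← hu]; exact NormedRing.inverse_continuousAt (R := SymSpace →L[ℂ] SymSpace) u
    have h2 : ContinuousAt (fun z => algebraMap ℂ (SymSpace →L[ℂ] SymSpace) z - L) z :=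
      (continuous_algebraMap ℂ (SymSpace →L[ℂ] SymSpace)).continuousAt.sub continuousAt_const
    exact (ContinuousAt.comp (f := fun z => algebraMap ℂ (SymSpace →L[ℂ] SymSpace) z - L) h1
      h2).continuousWithinAt
  have hintg := (ContinuousOn.circleIntegrable (E := SymSpace →L[ℂ] SymSpace) hε.1.le hcont).out
  -- On the eigenvector the resolvent is scalar, and the projection reduces to `(2πi)⁻¹ ∮ dz/(z - κ)
  -- = 1`.
  have hval : ∀ z ∈ sphere κ ε, resolvent L z w = (z - κ)⁻¹ • w := by
    intro z hz
    have hz0 : z - κ ≠ 0 := by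
      have hz' : ‖z - κ‖ = ε := by simpa [dist_eq_norm] using hz
      rw [← norm_ne_zero_iff, hz']
      exact hε.1.ne'
    have h1 : (algebraMap ℂ (SymSpace →L[ℂ] SymSpace) z - L) w = (z - κ) • w := by
      rw [sub_smul, ← hw]
      rfl
    have h2 := DFunLike.congr_fun (Ring.inverse_mul_cancel _ (hunit z hz)) w
    rw [mul_apply_eq_comp] at h2
    simp only [h1, map_smul] at h2
    rw [eq_inv_smul_iff₀ hz0]
    exact h2
  have hpi : (2 * (Real.pi : ℂ) * Complex.I) ≠ 0 := Complex.two_pi_I_ne_zero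
  have h1 : (∮ z in C(κ, ε), resolvent L z) w = ∮ z in C(κ, ε), resolvent L z w :=
    ContinuousLinearMap.intervalIntegral_apply hintg w
  rw [rieszProj, smul_apply, h1, circleIntegral.integral_congr hε.1.le hval,
    circleIntegral.integral_smul_const, circleIntegral.integral_sub_center_inv κ hε.1.ne',
    inv_smul_smul₀ hpi]

/-- Two operators that agree modulo the span of a common eigenvector `w` have the same spectrum
except for the eigenvalues of `w`; here the eigenvalue of the first operator is zero. -/
theorem mem_spectrum_of_eq_mod_eigenvector {X : Type*} [NormedAddCommGroup X] [NormedSpace ℂ X]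
    [CompleteSpace X] {A B : X →L[ℂ] X} {w : X} (hw : w ≠ 0) (hA : A w = 0) {b : ℂ}
    (hB : B w = b • w) (hAB : ∀ v, ∃ c : ℂ, A v - B v = c • w) {z : ℂ} (hz : z ≠ 0)
    (h : z ∈ spectrum ℂ A) : z ∈ spectrum ℂ B := by
  by_contra hzB
  refine h ?_
  change IsUnit (algebraMap ℂ (X →L[ℂ] X) z - A)
  have hu : IsUnit (algebraMap ℂ (X →L[ℂ] X) z - B) := not_not.1 hzB
  rw [ContinuousLinearMap.isUnit_iff_bijective] at hu ⊢
  have hAv (v : X) : (algebraMap ℂ (X →L[ℂ] X) z - A) v = z • v - A v := rfl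
  have hBv (v : X) : (algebraMap ℂ (X →L[ℂ] X) z - B) v = z • v - B v := rfl
  have hzb : z - b ≠ 0 := by
    intro hzb
    refine hw (hu.1 ?_)
    rw [hBv, hB, ← sub_smul, hzb, zero_smul, map_zero]
  refine ⟨(injective_iff_map_eq_zero _).2 fun v hv => ?_, fun u => ?_⟩
  · obtain ⟨c, hc⟩ := hAB v
    rw [hAv, sub_eq_zero] at hv
    -- If `A v = z v`, then `(z - B) v = c w`, so `v` lies on the line of `w`, where `A` vanishes.
    have h1 : v = (c / (z - b)) • w := by
      refine hu.1 ?_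
      rw [hBv, map_smul, hBv, hB, ← sub_smul, smul_smul, div_mul_cancel₀ _ hzb, ← hc, hv]
    have h2 : z • v = 0 := by rw [hv, h1, map_smul, hA, smul_zero]
    exact (smul_eq_zero.1 h2).resolve_left hz
  · obtain ⟨v, hv⟩ := hu.2 u
    obtain ⟨c, hc⟩ := hAB v
    -- Here `(z - A) v = u - c w` and `(z - A) w = z w`, so adding `(c/z) w` corrects the error.
    refine ⟨v + (c / z) • w, ?_⟩
    rw [map_add, map_smul, hAv, hAv, hA, sub_zero, smul_smul, div_mul_cancel₀ _ hz, ← hc, ← hv, hBv]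
    abel

/-! ### Comparison of the two spectra outside the disk. -/

theorem mainTheorem7
    -- the polynomial `s₀` and the point `s^*` of the ball around it
    (s₀ : SymSpace) (_hs₀ : IsPolynomial s₀)
    (sStar : SymSpace) (_hball : sStar ∈ Metric.ball s₀ varrho0)
    -- the domain of the operators (for instance the ball), and the branch `Z[s]`
    (U : Set SymSpace) (hU : IsOpen U) (hsU : sStar ∈ U)
    (r : ℝ) (Z : SymSpace → ℂ × ℂ → ℂ) (hZ : IsMidpointBranch U r Z)
    -- `s^*` is a fixed point of `ℛ_EKW`, with scaling `λ_* = lamE sStar`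
    (lamE : SymSpace → ℂ) (hE : IsScaling U r Z (fun _ => 0) lamE)
    (hfixE : renormEKW Z lamE sStar = sStar)
    -- the contour and the functional in the definition of `ℛ`
    (ε : ℝ) (hε : Isolates (fderiv ℂ (renormEKW Z lamE) sStar) (lamE sStar) ε)
    (l : SymSpace →L[ℂ] ℂ) (hl : l (psiEKW sStar) = 1)
    -- `s^*` is a fixed point of `ℛ`
    (lamR : SymSpace → ℂ) (hR : IsScaling U r Z (tRiesz Z lamE sStar ε l) lamR)
    (hRstar : lamR sStar = lamE sStar)
    (hfixR : renorm Z (tRiesz Z lamE sStar ε l) lamR sStar = sStar)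
    -- `s^*` is a fixed point of `ℛ_{c^*}`
    (cStar : ℂ) (hc : cStar = preCoeff Z sStar 3)
    (hp : ∀ s ∈ U, preCoeff Z s 2 ≠ 0)
    (lamC : SymSpace → ℂ) (hC : IsScaling U r Z (tCoeff Z cStar) lamC)
    (hCstar : lamC sStar = lamE sStar)
    (hfixC : renorm Z (tCoeff Z cStar) lamC sStar = sStar) :
    DifferentiableAt ℂ (renormEKW Z lamE) sStar ∧
    DifferentiableAt ℂ (renorm Z (tRiesz Z lamE sStar ε l) lamR) sStar ∧
    DifferentiableAt ℂ (renorm Z (tCoeff Z cStar) lamC) sStar ∧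
    spectrum ℂ (fderiv ℂ (renorm Z (tRiesz Z lamE sStar ε l) lamR) sStar)
        \ {z : ℂ | ‖z‖ ≤ deltaBound} ⊆
      spectrum ℂ (fderiv ℂ (renorm Z (tCoeff Z cStar) lamC) sStar)
        \ {z : ℂ | ‖z‖ ≤ deltaBound} := by
  have hpsi : psiEKW sStar ≠ 0 := fun h => by simp [h] at hl
  have hw : ∀ x y : ℂ, ‖x‖ < rho → ‖y‖ < rho → ev (psiEKW sStar) x y = _ :=
    fun x y hx hy => ev_psiEKW hpsi hx hy
  have hlam : lamE sStar ≠ 0 := hE.lam_ne_zero hsU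
  have hdE : DifferentiableAt ℂ (renormEKW Z lamE) sStar :=
    hE.differentiableAt_renorm hZ hU hsU (differentiableAt_const _)
  set L := fderiv ℂ (renormEKW Z lamE) sStar with hL
  have hLpsi : L (psiEKW sStar) = lamE sStar • psiEKW sStar :=
    hE.fderiv_renormEKW_psi hZ hU hsU hfixE hw
  set T : SymSpace →L[ℂ] ℂ := -(lamE sStar)⁻¹ • l.comp (rieszProj L (lamE sStar) ε) with hT
  have htR : HasFDerivAt (tRiesz Z lamE sStar ε l) (T.comp L) sStar :=
    T.hasFDerivAt.comp sStar (hdE.hasFDerivAt.sub_const sStar)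
  have htR0 : tRiesz Z lamE sStar ε l sStar = 0 := by
    simp [tRiesz, hfixE]
  have htC : DifferentiableAt ℂ (tCoeff Z cStar) sStar := by
    have h3 := differentiableAt_preCoeff hE hZ hU hsU 3
    have h2 := differentiableAt_preCoeff hE hZ hU hsU 2
    have h4 : DifferentiableAt ℂ (fun s => (cStar - preCoeff Z s 3) / preCoeff Z s 2) sStar := by
      simp only [div_eq_mul_inv]
      exact (h3.const_sub cStar).mul (h2.inv (hp sStar hsU))
    exact h4.const_mul (1 / 4)
  have htC0 : tCoeff Z cStar sStar = 0 := by
    simp [tCoeff, hc]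
  have hA := hE.fderiv_renorm_eq hR hZ hU hsU htR.differentiableAt htR0 hRstar hfixE hfixR hw
  have hB := hE.fderiv_renorm_eq hC hZ hU hsU htC htC0 hCstar hfixE hfixC hw
  refine ⟨hdE, hR.differentiableAt_renorm hZ hU hsU htR.differentiableAt,
    hC.differentiableAt_renorm hZ hU hsU htC, fun z hz => ⟨?_, hz.2⟩⟩
  have hz0 : z ≠ 0 := by
    rintro rfl
    exact hz.2 (by norm_num [deltaBound])
  refine mem_spectrum_of_eq_mod_eigenvector hpsi ?_
    (b := lamE sStar + lamE sStar * fderiv ℂ (tCoeff Z cStar) sStar (psiEKW sStar)) ?_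
    (fun v => ?_) hz0 hz.1
  -- The factor `-λ_*⁻¹` in `t` is chosen for this: the eigenvalue of `ψ` becomes `λ_* + λ_* · (-1)
  -- = 0`.
  · have h1 : T (L (psiEKW sStar)) = -1 := by
      rw [hLpsi, map_smul, hT, smul_apply, ContinuousLinearMap.comp_apply,
        rieszProj_apply_eigenvector hε hLpsi, hl, smul_eq_mul, smul_eq_mul]
      field_simp
    rw [hA, htR.fderiv, ContinuousLinearMap.comp_apply, h1, ← hL, hLpsi, ← add_smul]
    simp
  · rw [hB, ← hL, hLpsi, ← add_smul]
  · refine ⟨lamE sStar * fderiv ℂ (tRiesz Z lamE sStar ε l) sStar v -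
      lamE sStar * fderiv ℂ (tCoeff Z cStar) sStar v, ?_⟩
    rw [hA, hB, sub_smul]
    abel
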